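/- Let $\mathbf{k}$ be a field, let $x=(x_1,\dots,x_n)$, and let $\mathcal{C}$ denote one of the rings $\mathbf{k}[x]$, $\mathcal{O}_{alg}$ (the localization of $\mathbf{k}[x]$ at the origin), $\hat{\mathcal O}=\mathbf{k}[[x]]$ or, if $\mathbf{k}=\mathbb{C}$, $\mathcal{O}_0=\mathbb{C}\{x\}$ (germs at $0$ of analytic functions), all regarded as subrings of $\hat{\mathcal O}$. Denote by $D$, $D_{alg}$, $\hat D$, $\mathcal{D}_0$ the corresponding rings $\mathcal{R}$ of differential operators $\sum_\beta c_\beta(x)\partial^\beta$ with coefficients in $\mathcal{C}$, where $\partial_i c-c\,\partial_i=\partial c/\partial x_i$. Let $h_{(0,1)}(\mathcal{R})$ be the $\mathbf{k}$-algebra generated by $\mathcal{C}$, $\partial_1,\dots,\partial_n$ and a variable $h$ with $\partial_i c-c\,\partial_i=\frac{\partial c}{\partial x_i}h$ as the only non-trivial commutation relations; its elements are written uniquely as finite sums $\sum_{\beta,m} c_{\beta,m}(x)\partial^\beta h^m$ with $c_{\beta,m}\in\mathcal{C}$. For $P=\sum_\beta c_\beta\partial^\beta\in\mathcal{R}$ of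 degree $d=\max\{|\beta| : c_\beta\neq 0\}$ put $h_{(0,1)}(P)=\sum_\beta c_\beta\partial^\beta h^{d-|\beta|}$, and for a left ideal $I\subset\mathcal{R}$ let $h_{(0,1)}(I)$ be the left ideal of $h_{(0,1)}(\mathcal{R})$ generated by all $h_{(0,1)}(P)$, $P\in I$. Let $w=(u,v)\in W_{loc}=\{(u,v)\in\mathbb{R}^{2n} : u_i\le 0,\ u_i+v_i\ge 0 \text{ for all } i\}$. For $P\in h_{(0,1)}(\mathcal{R})$ let $\mathrm{ord}^w(P)$ be the maximum of $u\cdot\alpha+v\cdot\beta$ over the monomials $x^\alpha\partial^\beta h^m$ occurring in $P$; let $F_r=\{P : \mathrm{ord}^w(P)\le r\}$ and $F_{<r}=\{P:\mathrm{ord}^w(P)<r\}$ (both containing $0$), and let $\mathrm{gr}^w(h_{(0,1)}(\mathcal{R}))=\bigoplus_{r\in\mathbb{R}}F_r/F_{<r}$ be the associated graded ring. The initial form $\mathrm{in}_w(P)$ is the class of $P$ in $F_r/F_{<r}$ for $r=\mathrm{ord}^w(P)$ (and $\mathrm{in}_w(0)=0$), and for a left ideal $J$ of $h_{(0,1)}(\mathcal{R})$,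 $\mathrm{in}_w(J)$ is the left ideal of $\mathrm{gr}^w(h_{(0,1)}(\mathcal{R}))$ generated by the $\mathrm{in}_w(P)$, $P\in J$. For rings $\mathcal{R}\subset\mathcal{R}'$ as above and a left ideal $J$ of $h_{(0,1)}(\mathcal R)$, $\mathrm{gr}^w(h_{(0,1)}(\mathcal{R}'))\,\mathrm{in}_w(J)$ denotes the left ideal generated by the image of $\mathrm{in}_w(J)$ under the canonical map $\mathrm{gr}^w(h_{(0,1)}(\mathcal{R}))\to\mathrm{gr}^w(h_{(0,1)}(\mathcal{R}'))$. Then: (1) for every left ideal $I\subset D$, $\ \mathrm{gr}^w(h_{(0,1)}(D_{alg}))\,\mathrm{in}_w(h_{(0,1)}(I))=\mathrm{in}_w(h_{(0,1)}(D_{alg}I))$; (2) for every left ideal $I\subset D_{alg}$, $\ \mathrm{gr}^w(h_{(0,1)}(\hat D))\,\mathrm{in}_w(h_{(0,1)}(I))=\mathrm{in}_w(h_{(0,1)}(\hat D I))$; (3) when $\mathbf{k}=\mathbb{C}$: (a) for every left ideal $I\subset D_{alg}$, $\ \mathrm{gr}^w(h_{(0,1)}(\mathcal{D}_0))\,\mathrm{in}_w(h_{(0,1)}(I))=\mathrm{in}_w(h_{(0,1)}(\mathcal{D}_0I))$;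 and (b) for every left ideal $I\subset\mathcal{D}_0$, $\ \mathrm{gr}^w(h_{(0,1)}(\hat D))\,\mathrm{in}_w(h_{(0,1)}(I))=\mathrm{in}_w(h_{(0,1)}(\hat D I))$. -/

import Mathlib

open scoped DirectSum

noncomputable section

namespace LocalGroebner

/-! ### Rings of differential operators over a ring with commuting derivations -/

/-- A family of `n` pairwise commuting derivations of a commutative ring `B`. -/
structure CommDer (B : Type*) [CommRing B] (n : ℕ) where
  /-- the derivations -/
  der : Fin n → B →+ B
  leibniz : ∀ i a b, der i (a * b) = a * der i b + der i a * b
  comm : ∀ i j b, der i (der j b) = der j (der i b)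

/-- The ring `B[∂₁, …, ∂ₙ]` generated by `B` and commuting symbols `∂ᵢ` subject to
`∂ᵢ b - b ∂ᵢ = δᵢ(b)`.  An element is given by its (unique) normal form `∑_β b_β ∂^β`, that is by
the finitely supported family of its coefficients `b_β ∈ B`. -/
def DiffOp {B : Type*} [CommRing B] {n : ℕ} (_ : CommDer B n) : Type _ :=
  (Fin n →₀ ℕ) →₀ B

theorem CommDer.der_one {B : Type*} [CommRing B] {n : ℕ} (Δ : CommDer B n) (i : Fin n) :
    Δ.der i 1 = 0 := by
  have h := Δ.leibniz i 1 1
  rw [one_mul, one_mul, mul_one] at h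
  exact left_eq_add.1 h

namespace DiffOp

variable {B : Type*} [CommRing B] {n : ℕ} (Δ : CommDer B n)

instance : AddCommGroup (DiffOp Δ) := inferInstanceAs (AddCommGroup ((Fin n →₀ ℕ) →₀ B))

variable {Δ} in
/-- The coefficient `b_β` of `∂^β` in the normal form. -/
def coeff (β : Fin n →₀ ℕ) : DiffOp Δ →+ B := Finsupp.applyAddHom β

/-- The operator `b ∂^β`. -/
def mono (β : Fin n →₀ ℕ) : B →+ DiffOp Δ := Finsupp.singleAddHom β

variable {Δ} in
/-- The finite set of those `β` for which `∂^β` occurs in the normal form. -/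
def supp (P : DiffOp Δ) : Finset (Fin n →₀ ℕ) := Finsupp.support P

variable {Δ}

@[ext] theorem ext {P Q : DiffOp Δ} (h : ∀ β, coeff β P = coeff β Q) : P = Q :=
  Finsupp.ext h

theorem mem_supp {P : DiffOp Δ} {β : Fin n →₀ ℕ} : β ∈ supp P ↔ coeff β P ≠ 0 :=
  Finsupp.mem_support_iff

theorem coeff_mono (β γ : Fin n →₀ ℕ) (b : B) :
    coeff γ (mono Δ β b) = if β = γ then b else 0 := by
  classical
  exact Finsupp.single_apply

theorem sum_mono (P : DiffOp Δ) : ∑ β ∈ supp P, mono Δ β (coeff β P) = P :=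
  Finsupp.sum_single P

@[elab_as_elim] theorem induction_mono {p : DiffOp Δ → Prop} (P : DiffOp Δ) (zero : p 0)
    (add : ∀ P Q, p P → p Q → p (P + Q)) (mono : ∀ β b, p (mono Δ β b)) : p P :=
  Finsupp.induction_linear P zero add mono

theorem addHom_ext {M : Type*} [AddMonoid M] {f g : DiffOp Δ →+ M}
    (h : ∀ β b, f (mono Δ β b) = g (mono Δ β b)) : f = g :=
  Finsupp.addHom_ext h

variable (Δ)

/-- The additive map out of `B[∂]` with prescribed values on the `b ∂^β`. -/
def liftAdd {M : Type*} [AddCommMonoid M] (f : (Fin n →₀ ℕ) → B →+ M) : DiffOp Δ →+ M :=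
  Finsupp.liftAddHom f

variable {Δ} in
theorem liftAdd_mono {M : Type*} [AddCommMonoid M] (f : (Fin n →₀ ℕ) → B →+ M)
    (β : Fin n →₀ ℕ) (b : B) : liftAdd Δ f (mono Δ β b) = f β b :=
  Finsupp.liftAddHom_apply_single f β b

variable {Δ} in
theorem liftAdd_apply {M : Type*} [AddCommMonoid M] (f : (Fin n →₀ ℕ) → B →+ M)
    (P : DiffOp Δ) : liftAdd Δ f P = ∑ β ∈ supp P, f β (coeff β P) := rfl

/-- Left multiplication by `b`:  `b · ∑ b_γ ∂^γ = ∑ (b b_γ) ∂^γ`. -/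
def lcoef (b : B) : Module.End ℤ (DiffOp Δ) :=
  (liftAdd Δ fun γ => (mono Δ γ).comp (AddMonoidHom.mulLeft b)).toIntLinearMap

/-- Left multiplication by `∂ᵢ`:  `∂ᵢ · ∑ b_γ ∂^γ = ∑ (b_γ ∂^(γ+eᵢ) + δᵢ(b_γ) ∂^γ)`. -/
def lpartial (i : Fin n) : Module.End ℤ (DiffOp Δ) :=
  (liftAdd Δ fun γ =>
    mono Δ (γ + Finsupp.single i 1) +
      (mono Δ γ).comp (Δ.der i)).toIntLinearMap

variable {Δ}

theorem lcoef_mono (a b : B) (β : Fin n →₀ ℕ) :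
    lcoef Δ a (mono Δ β b) = mono Δ β (a * b) := liftAdd_mono _ _ _

theorem lpartial_mono (i : Fin n) (b : B) (β : Fin n →₀ ℕ) :
    lpartial Δ i (mono Δ β b) =
      mono Δ (β + Finsupp.single i 1) b + mono Δ β (Δ.der i b) := liftAdd_mono _ _ _

theorem end_ext {M : Type*} [AddCommGroup M] {S T : DiffOp Δ →ₗ[ℤ] M}
    (h : ∀ β b, S (mono Δ β b) = T (mono Δ β b)) : S = T :=
  LinearMap.ext fun P =>
    DFunLike.congr_fun (addHom_ext (f := S.toAddMonoidHom) (g := T.toAddMonoidHom) h) P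

theorem lcoef_one : lcoef Δ 1 = 1 := end_ext fun β b => by
  rw [lcoef_mono, one_mul, Module.End.one_apply]

theorem lcoef_zero : lcoef Δ 0 = 0 := end_ext fun β b => by
  rw [lcoef_mono, zero_mul, map_zero, LinearMap.zero_apply]

theorem lcoef_add (a b : B) : lcoef Δ (a + b) = lcoef Δ a + lcoef Δ b := end_ext fun β c => by
  rw [LinearMap.add_apply, lcoef_mono, lcoef_mono, lcoef_mono, add_mul, map_add]

theorem lcoef_mul (a b : B) : lcoef Δ (a * b) = lcoef Δ a * lcoef Δ b := end_ext fun β c => by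
  rw [Module.End.mul_apply, lcoef_mono, lcoef_mono, lcoef_mono, mul_assoc]

theorem lpartial_comm (i j : Fin n) : Commute (lpartial Δ i) (lpartial Δ j) := by
  refine end_ext fun β b => ?_
  simp only [Module.End.mul_apply, lpartial_mono, map_add]
  rw [Δ.comm i j, add_right_comm β]
  abel

theorem lpartial_lcoef (i : Fin n) (b : B) :
    lpartial Δ i * lcoef Δ b = lcoef Δ b * lpartial Δ i + lcoef Δ (Δ.der i b) := by
  refine end_ext fun β c => ?_
  simp only [Module.End.mul_apply, LinearMap.add_apply, lpartial_mono, map_add, lcoef_mono,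
    Δ.leibniz]
  abel

theorem lpow_comm (β : Fin n →₀ ℕ) : Set.Pairwise ((Finset.univ : Finset (Fin n)) : Set (Fin n))
    (Function.onFun Commute fun i => lpartial Δ i ^ β i) :=
  fun i _ j _ _ => (lpartial_comm i j).pow_pow _ _

variable (Δ) in
/-- Left multiplication by `∂^β = ∂₁^β₁ ⋯ ∂ₙ^βₙ`. -/
def lpow (β : Fin n →₀ ℕ) : Module.End ℤ (DiffOp Δ) :=
  Finset.univ.noncommProd (fun i => lpartial Δ i ^ β i) (lpow_comm β)

theorem lpow_zero : lpow Δ 0 = 1 :=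
  (Finset.noncommProd_eq_pow_card _ _ _ 1 (fun i _ => by simp)).trans (one_pow _)

theorem lpow_add_single (β : Fin n →₀ ℕ) (i : Fin n) :
    lpow Δ (β + Finsupp.single i 1) = lpartial Δ i * lpow Δ β := by
  classical
  rw [lpow, lpow, ← Finset.mul_noncommProd_erase _ (Finset.mem_univ i),
    ← Finset.mul_noncommProd_erase _ (Finset.mem_univ i) (fun j => lpartial Δ j ^ β j),
    ← mul_assoc]
  congr 1
  · simp [pow_succ']
  · refine Finset.noncommProd_congr rfl ?_ _
    intro j hj
    simp [Finsupp.single_eq_of_ne (Finset.ne_of_mem_erase hj)]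

theorem lpow_mem (S : Submonoid (Module.End ℤ (DiffOp Δ))) (h : ∀ i, lpartial Δ i ∈ S)
    (β : Fin n →₀ ℕ) : lpow Δ β ∈ S :=
  Submonoid.noncommProd_mem _ _ _ _ fun i _ => pow_mem (h i) _

@[elab_as_elim] theorem induction_add_single {p : (Fin n →₀ ℕ) → Prop} (β : Fin n →₀ ℕ)
    (zero : p 0) (add : ∀ β i, p β → p (β + Finsupp.single i 1)) : p β := by
  obtain ⟨m, hm⟩ : ∃ m, β.degree = m := ⟨_, rfl⟩
  induction m generalizing β with
  | zero =>
    rw [Finsupp.degree_eq_zero_iff] at hm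
    exact hm ▸ zero
  | succ m ih =>
    have hβ : β ≠ 0 := fun h => by simp [h] at hm
    obtain ⟨i, hi⟩ := Finsupp.ne_iff.1 hβ
    have hle : Finsupp.single i 1 ≤ β := by
      rw [Finsupp.single_le_iff]
      exact Nat.one_le_iff_ne_zero.2 hi
    obtain ⟨γ, rfl⟩ := exists_add_of_le hle
    rw [add_comm (Finsupp.single i 1)] at hm ⊢
    exact add γ i (ih γ (by simpa using hm))

theorem lpow_mono_one (β δ : Fin n →₀ ℕ) :
    lpow Δ β (mono Δ δ 1) = mono Δ (β + δ) 1 := by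
  induction β using induction_add_single with
  | zero => rw [lpow_zero, Module.End.one_apply, zero_add]
  | add β i ih =>
    rw [lpow_add_single, Module.End.mul_apply, ih, lpartial_mono, Δ.der_one, map_zero, add_zero,
      add_right_comm]

/-- Left multiplication by `∑ a_β ∂^β`, as the sum of the compositions `a_β · ∂^β`. -/
def lmul (P : DiffOp Δ) : Module.End ℤ (DiffOp Δ) :=
  ∑ β ∈ supp P, lcoef Δ (coeff β P) * lpow Δ β

theorem lmul_eq_liftAdd (P : DiffOp Δ) :
    lmul P = liftAdd Δ (fun β => AddMonoidHom.mk' (fun a => lcoef Δ a * lpow Δ β)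
      fun a b => by rw [lcoef_add, add_mul]) P := rfl

theorem lmul_add (P Q : DiffOp Δ) : lmul (P + Q) = lmul P + lmul Q := by
  simp only [lmul_eq_liftAdd, map_add]

theorem lmul_zero : lmul (0 : DiffOp Δ) = 0 := by
  simp only [lmul_eq_liftAdd, map_zero]

theorem lmul_mono (β : Fin n →₀ ℕ) (a : B) : lmul (mono Δ β a) = lcoef Δ a * lpow Δ β := by
  rw [lmul_eq_liftAdd, liftAdd_mono]; rfl

theorem lmul_lcoef (a : B) (Q : DiffOp Δ) : lmul (lcoef Δ a Q) = lcoef Δ a * lmul Q := by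
  induction Q using induction_mono with
  | zero => rw [map_zero, lmul_zero, mul_zero]
  | add P Q hP hQ => rw [map_add, lmul_add, lmul_add, hP, hQ, mul_add]
  | mono β b => rw [lcoef_mono, lmul_mono, lmul_mono, lcoef_mul, mul_assoc]

theorem lmul_lpartial (i : Fin n) (Q : DiffOp Δ) :
    lmul (lpartial Δ i Q) = lpartial Δ i * lmul Q := by
  induction Q using induction_mono with
  | zero => rw [map_zero, lmul_zero, mul_zero]
  | add P Q hP hQ => rw [map_add, lmul_add, lmul_add, hP, hQ, mul_add]
  | mono β b =>
    rw [lpartial_mono, lmul_add, lmul_mono, lmul_mono, lmul_mono, lpow_add_single, ← mul_assoc,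
      ← mul_assoc, lpartial_lcoef, add_mul]

/-- A set of additive operators that contains the left multiplications by the `∂ᵢ` and by the
coefficients of `P` and that is closed under sums and compositions contains the left
multiplication by `P`. -/
theorem lmul_mem (S : Subsemiring (Module.End ℤ (DiffOp Δ))) (P : DiffOp Δ)
    (hc : ∀ β, lcoef Δ (coeff β P) ∈ S) (hd : ∀ i, lpartial Δ i ∈ S) : lmul P ∈ S :=
  sum_mem fun β _ => mul_mem (hc β) (lpow_mem S.toSubmonoid hd β)

theorem lmul_lmul (P Q : DiffOp Δ) : lmul (lmul P Q) = lmul P * lmul Q := by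
  let S : Subsemiring (Module.End ℤ (DiffOp Δ)) :=
    { carrier := {T | ∀ Q, lmul (T Q) = T * lmul Q}
      mul_mem' := fun {T U} hT hU Q => by
        rw [Module.End.mul_apply, hT, hU, mul_assoc]
      one_mem' := fun Q => by rw [Module.End.one_apply, one_mul]
      add_mem' := fun {T U} hT hU Q => by
        rw [LinearMap.add_apply, lmul_add, hT, hU, add_mul]
      zero_mem' := fun Q => by rw [LinearMap.zero_apply, zero_mul, lmul_zero] }
  exact lmul_mem S P (fun β => lmul_lcoef _) lmul_lpartial Q

instance : Mul (DiffOp Δ) := ⟨fun P Q => lmul P Q⟩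

instance : One (DiffOp Δ) := ⟨mono Δ 0 1⟩

theorem mul_def (P Q : DiffOp Δ) : P * Q = lmul P Q := rfl

theorem one_def : (1 : DiffOp Δ) = mono Δ 0 1 := rfl

instance : Ring (DiffOp Δ) :=
  { (inferInstance : AddCommGroup (DiffOp Δ)) with
    mul := (· * ·)
    one := 1
    mul_assoc := fun P Q R => by
      rw [mul_def, mul_def, mul_def, mul_def, lmul_lmul, Module.End.mul_apply]
    one_mul := fun P => by
      rw [mul_def, one_def, lmul_mono, lpow_zero, lcoef_one, mul_one, Module.End.one_apply]
    mul_one := fun P => by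
      rw [mul_def, one_def]
      conv_rhs => rw [← sum_mono P]
      rw [lmul, LinearMap.sum_apply]
      refine Finset.sum_congr rfl fun β _ => ?_
      rw [Module.End.mul_apply, lpow_mono_one, add_zero, lcoef_mono, mul_one]
    left_distrib := fun P Q R => map_add (lmul P) Q R
    right_distrib := fun P Q R => by
      rw [mul_def, mul_def, mul_def, lmul_add, LinearMap.add_apply]
    zero_mul := fun P => by rw [mul_def, lmul_zero, LinearMap.zero_apply]
    mul_zero := fun P => map_zero (lmul P) }

/-- The defining relation `∂ᵢ b = b ∂ᵢ + δᵢ(b)`. -/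
theorem partial_mul_coef (i : Fin n) (b : B) :
    mono Δ (Finsupp.single i 1) 1 * mono Δ 0 b =
      mono Δ 0 b * mono Δ (Finsupp.single i 1) 1 + mono Δ 0 (Δ.der i b) := by
  have h1 : lmul (mono Δ (Finsupp.single i 1) 1) = lpartial Δ i := by
    rw [lmul_mono, lcoef_one, one_mul, ← zero_add (Finsupp.single i 1), lpow_add_single, lpow_zero,
      mul_one]
  rw [mul_def, mul_def, h1, lpartial_mono, zero_add, lmul_mono, lpow_zero, mul_one, lcoef_mono,
    mul_one]

/-- The normal form `∑ b_β ∂^β` is the sum of the products of the `b_β` and the `∂^β`. -/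
theorem coef_mul_pow (β : Fin n →₀ ℕ) (b : B) : mono Δ 0 b * mono Δ β 1 = mono Δ β b := by
  rw [mul_def, lmul_mono, lpow_zero, mul_one, lcoef_mono, mul_one]

/-- `∂^β ∂^γ = ∂^(β+γ)`. -/
theorem pow_mul_pow (β γ : Fin n →₀ ℕ) : mono Δ β 1 * mono Δ γ 1 = mono Δ (β + γ) 1 := by
  rw [mul_def, lmul_mono, lcoef_one, one_mul, lpow_mono_one]

end DiffOp
end LocalGroebner
namespace LocalGroebner

/-! ### Filtered rings and their associated graded rings -/

/-- An increasing filtration of a ring `R` by additive subgroups `F_r`, `r ∈ ℝ`, with `1 ∈ F_0` and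
`F_r F_s ⊆ F_{r+s}`. -/
structure RingFiltration (R : Type*) [Ring R] where
  /-- the filtration steps -/
  F : ℝ → AddSubgroup R
  mono : Monotone F
  one_mem : (1 : R) ∈ F 0
  mul_mem : ∀ {r s : ℝ} {a b : R}, a ∈ F r → b ∈ F s → a * b ∈ F (r + s)

namespace RingFiltration

variable {R S : Type*} [Ring R] [Ring S]

/-- `F_{<r}`, the union of the `F_s` with `s < r`. -/
def lt (𝓕 : RingFiltration R) (r : ℝ) : AddSubgroup R := ⨆ s : Set.Iio r, 𝓕.F s

theorem mem_lt {𝓕 : RingFiltration R} {r : ℝ} {a : R} :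
    a ∈ 𝓕.lt r ↔ ∃ s < r, a ∈ 𝓕.F s := by
  have : Nonempty (Set.Iio r) := ⟨⟨r - 1, by simp⟩⟩
  rw [lt, AddSubgroup.mem_iSup_of_directed]
  · simp
  · exact (fun i j => ⟨i ⊔ j, 𝓕.mono (le_sup_left (a := i)), 𝓕.mono (le_sup_right (a := i))⟩)

/-- The graded piece `F_r / F_{<r}`. -/
abbrev Piece (𝓕 : RingFiltration R) (r : ℝ) : Type _ :=
  𝓕.F r ⧸ (𝓕.lt r).addSubgroupOf (𝓕.F r)

/-- The class in `F_r / F_{<r}` of an element of `F_r`. -/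
def cls (𝓕 : RingFiltration R) (r : ℝ) : 𝓕.F r →+ 𝓕.Piece r :=
  QuotientAddGroup.mk' _

theorem cls_eq_cls {𝓕 : RingFiltration R} {r : ℝ} {a b : 𝓕.F r} :
    𝓕.cls r a = 𝓕.cls r b ↔ (-a + b : R) ∈ 𝓕.lt r := by
  rw [cls, QuotientAddGroup.mk'_apply, QuotientAddGroup.mk'_apply, QuotientAddGroup.eq]
  rfl

theorem cls_surj {𝓕 : RingFiltration R} {r : ℝ} (x : 𝓕.Piece r) : ∃ a, 𝓕.cls r a = x :=
  QuotientAddGroup.mk'_surjective _ x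

theorem mul_mem_lt_left {𝓕 : RingFiltration R} {r s : ℝ} {a b : R} (ha : a ∈ 𝓕.lt r)
    (hb : b ∈ 𝓕.F s) : a * b ∈ 𝓕.lt (r + s) := by
  obtain ⟨t, ht, ha⟩ := mem_lt.1 ha
  exact mem_lt.2 ⟨t + s, by linarith, 𝓕.mul_mem ha hb⟩

theorem mul_mem_lt_right {𝓕 : RingFiltration R} {r s : ℝ} {a b : R} (ha : a ∈ 𝓕.F r)
    (hb : b ∈ 𝓕.lt s) : a * b ∈ 𝓕.lt (r + s) := by
  obtain ⟨t, ht, hb⟩ := mem_lt.1 hb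
  exact mem_lt.2 ⟨r + t, by linarith, 𝓕.mul_mem ha hb⟩

/-- The product of `a ∈ F_r` and `b ∈ F_s`, as an element of `F_{r+s}`. -/
def fmul (𝓕 : RingFiltration R) {r s : ℝ} (a : 𝓕.F r) (b : 𝓕.F s) : 𝓕.F (r + s) :=
  ⟨a * b, 𝓕.mul_mem a.2 b.2⟩

/-- The product `F_r / F_{<r} × F_s / F_{<s} → F_{r+s} / F_{<r+s}` induced by that of `R`. -/
def gmul (𝓕 : RingFiltration R) {r s : ℝ} (x : 𝓕.Piece r) (y : 𝓕.Piece s) : 𝓕.Piece (r + s) :=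
  Quotient.map₂ (𝓕.fmul (r := r) (s := s)) (by
    intro a a' ha b b' hb
    have ha' : (-a + a' : R) ∈ 𝓕.lt r := by
      have := QuotientAddGroup.leftRel_apply.1 ha
      exact this
    have hb' : (-b + b' : R) ∈ 𝓕.lt s := by
      have := QuotientAddGroup.leftRel_apply.1 hb
      exact this
    refine QuotientAddGroup.leftRel_apply.2 ?_
    change -(a * b : R) + a' * b' ∈ 𝓕.lt (r + s)
    have h : -(a * b : R) + a' * b' = (-a + a') * b + a' * (-b + b') := by noncomm_ring
    rw [h]
    exact add_mem (mul_mem_lt_left ha' b.2) (mul_mem_lt_right a'.2 hb')) x y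

theorem mk_cls_eq {𝓕 : RingFiltration R} {r s : ℝ} (h : r = s) {a : 𝓕.F r} {b : 𝓕.F s}
    (hab : (a : R) = b) :
    (⟨r, 𝓕.cls r a⟩ : GradedMonoid 𝓕.Piece) = ⟨s, 𝓕.cls s b⟩ := by
  subst h
  rw [Subtype.ext hab]

instance (𝓕 : RingFiltration R) : GradedMonoid.GMul 𝓕.Piece := ⟨𝓕.gmul⟩

theorem gmul_cls {𝓕 : RingFiltration R} {r s : ℝ} (a : 𝓕.F r) (b : 𝓕.F s) :
    GradedMonoid.GMul.mul (𝓕.cls r a) (𝓕.cls s b) = 𝓕.cls (r + s) (𝓕.fmul a b) := rfl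

instance (𝓕 : RingFiltration R) : GradedMonoid.GOne 𝓕.Piece := ⟨𝓕.cls 0 ⟨1, 𝓕.one_mem⟩⟩

instance (𝓕 : RingFiltration R) : DirectSum.GRing 𝓕.Piece where
  mul_zero := by
    intro r s x
    obtain ⟨a, rfl⟩ := cls_surj x
    rw [← map_zero (𝓕.cls s), gmul_cls, ← map_zero (𝓕.cls (r + s))]
    exact congrArg _ (Subtype.ext (mul_zero _))
  zero_mul := by
    intro r s y
    obtain ⟨b, rfl⟩ := cls_surj y
    rw [← map_zero (𝓕.cls r), gmul_cls, ← map_zero (𝓕.cls (r + s))]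
    exact congrArg _ (Subtype.ext (zero_mul _))
  mul_add := by
    intro r s x y z
    obtain ⟨a, rfl⟩ := cls_surj x
    obtain ⟨b, rfl⟩ := cls_surj y
    obtain ⟨c, rfl⟩ := cls_surj z
    rw [← map_add, gmul_cls, gmul_cls, gmul_cls, ← map_add]
    exact congrArg _ (Subtype.ext (mul_add _ _ _))
  add_mul := by
    intro r s x y z
    obtain ⟨a, rfl⟩ := cls_surj x
    obtain ⟨b, rfl⟩ := cls_surj y
    obtain ⟨c, rfl⟩ := cls_surj z
    rw [← map_add, gmul_cls, gmul_cls, gmul_cls, ← map_add]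
    exact congrArg _ (Subtype.ext (add_mul _ _ _))
  one_mul := by
    rintro ⟨r, x⟩
    obtain ⟨a, rfl⟩ := cls_surj x
    exact mk_cls_eq (zero_add r) (one_mul _)
  mul_one := by
    rintro ⟨r, x⟩
    obtain ⟨a, rfl⟩ := cls_surj x
    exact mk_cls_eq (add_zero r) (mul_one _)
  mul_assoc := by
    rintro ⟨r, x⟩ ⟨s, y⟩ ⟨t, z⟩
    obtain ⟨a, rfl⟩ := cls_surj x
    obtain ⟨b, rfl⟩ := cls_surj y
    obtain ⟨c, rfl⟩ := cls_surj z
    exact mk_cls_eq (add_assoc r s t) (mul_assoc _ _ _)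
  natCast := fun m => m • 𝓕.cls 0 ⟨1, 𝓕.one_mem⟩
  natCast_zero := zero_nsmul _
  natCast_succ := fun m => succ_nsmul _ _
  intCast := fun m => m • 𝓕.cls 0 ⟨1, 𝓕.one_mem⟩
  intCast_ofNat := fun m => natCast_zsmul _ _
  intCast_negSucc_ofNat := fun m => negSucc_zsmul _ _

/-- The associated graded ring `gr(R) = ⨁_{r ∈ ℝ} F_r / F_{<r}`. -/
abbrev Gr (𝓕 : RingFiltration R) : Type _ := ⨁ r, 𝓕.Piece r

/-- The homogeneous element of `gr(R)` given by the class of `a ∈ F_r` in `F_r / F_{<r}`. -/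
def symb (𝓕 : RingFiltration R) (r : ℝ) (a : 𝓕.F r) : 𝓕.Gr :=
  DirectSum.of 𝓕.Piece r (𝓕.cls r a)

/-- The map `F_r / F_{<r} → G_r / G_{<r}` induced by a map of filtered rings. -/
def pieceMap {𝓕 : RingFiltration R} {𝓖 : RingFiltration S} (f : R →+* S)
    (hf : ∀ r a, a ∈ 𝓕.F r → f a ∈ 𝓖.F r) (r : ℝ) : 𝓕.Piece r →+ 𝓖.Piece r :=
  QuotientAddGroup.map _ _
    (((f : R →+ S).comp (𝓕.F r).subtype).codRestrict (𝓖.F r) fun a => hf r a a.2) (by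
      intro a ha
      obtain ⟨s, hs, ha⟩ := mem_lt.1 (AddSubgroup.mem_addSubgroupOf.1 ha)
      exact AddSubgroup.mem_addSubgroupOf.2 (mem_lt.2 ⟨s, hs, hf s _ ha⟩))

/-- The canonical ring homomorphism `gr(R) → gr(S)` induced by a map of filtered rings. -/
def grMap {𝓕 : RingFiltration R} {𝓖 : RingFiltration S} (f : R →+* S)
    (hf : ∀ r a, a ∈ 𝓕.F r → f a ∈ 𝓖.F r) : 𝓕.Gr →+* 𝓖.Gr :=
  DirectSum.toSemiring (fun r => (DirectSum.of 𝓖.Piece r).comp (pieceMap f hf r))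
    (by
      change DirectSum.of 𝓖.Piece 0 (𝓖.cls 0 ⟨f 1, _⟩) = DirectSum.of 𝓖.Piece 0 (𝓖.cls 0 ⟨1, _⟩)
      congr 3
      exact map_one f)
    (by
      intro r s x y
      obtain ⟨a, rfl⟩ := cls_surj x
      obtain ⟨b, rfl⟩ := cls_surj y
      simp only [AddMonoidHom.comp_apply]
      rw [DirectSum.of_mul_of]
      change DirectSum.of 𝓖.Piece (r + s) (𝓖.cls _ ⟨f (a * b), _⟩) =
        DirectSum.of 𝓖.Piece (r + s) (𝓖.cls _ ⟨f a * f b, _⟩)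
      congr 3
      exact map_mul f _ _)

theorem grMap_symb {𝓕 : RingFiltration R} {𝓖 : RingFiltration S} (f : R →+* S)
    (hf : ∀ r a, a ∈ 𝓕.F r → f a ∈ 𝓖.F r) (r : ℝ) (a : 𝓕.F r) :
    grMap f hf (𝓕.symb r a) = 𝓖.symb r ⟨f a, hf r a a.2⟩ :=
  DirectSum.toSemiring_of _ _ _ _ _

end RingFiltration
end LocalGroebner
/-! ### The coefficient rings -/

namespace LocalGroebner

section Coefficients

variable (k : Type*) [Field k] (n : ℕ)

/-- A `k`-algebra of formal power series in `n` variables that is closed under the partial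
derivatives. -/
structure CoeffRing extends Subalgebra k (MvPowerSeries (Fin n) k) where
  pderiv_mem : ∀ (i : Fin n) {f : MvPowerSeries (Fin n) k},
    f ∈ carrier → MvPowerSeries.pderiv k i f ∈ carrier

namespace CoeffRing

/-- The polynomial ring `k[x]`, inside `k[[x]]`. -/
def poly : CoeffRing k n where
  toSubalgebra := (MvPolynomial.coeToMvPowerSeries.algHom (σ := Fin n) (R := k) k).range
  pderiv_mem := by
    rintro i _ ⟨p, rfl⟩
    refine ⟨MvPolynomial.pderiv i p, ?_⟩
    simp [MvPowerSeries.pderiv_coe]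

/-- The localization of `k[x]` at the origin, inside `k[[x]]`: the power series of the fractions
`p / q` of polynomials with `q(0) ≠ 0`. -/
def alg : CoeffRing k n where
  carrier := {f | ∃ p q : MvPolynomial (Fin n) k, MvPolynomial.constantCoeff q ≠ 0 ∧
    (q : MvPowerSeries (Fin n) k) * f = p}
  mul_mem' := by
    rintro f g ⟨p, q, hq, hf⟩ ⟨p', q', hq', hg⟩
    refine ⟨p * p', q * q', by simpa using ⟨hq, hq'⟩, ?_⟩
    push_cast
    rw [← hf, ← hg]
    ring
  add_mem' := by
    rintro f g ⟨p, q, hq, hf⟩ ⟨p', q', hq', hg⟩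
    refine ⟨p * q' + q * p', q * q', by simpa using ⟨hq, hq'⟩, ?_⟩
    push_cast
    rw [← hf, ← hg]
    ring
  algebraMap_mem' := fun c => ⟨MvPolynomial.C c, 1, by simp, by
    simp [MvPowerSeries.algebraMap_apply]⟩
  pderiv_mem := by
    rintro i f ⟨p, q, hq, hf⟩
    refine ⟨q * MvPolynomial.pderiv i p - MvPolynomial.pderiv i q * p, q * q,
      by simpa using hq, ?_⟩
    have h := congrArg (MvPowerSeries.pderiv k i) hf
    rw [Derivation.leibniz, MvPowerSeries.pderiv_coe, MvPowerSeries.pderiv_coe, smul_eq_mul,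
      smul_eq_mul] at h
    have h1 : ((q * MvPolynomial.pderiv i p - MvPolynomial.pderiv i q * p :
        MvPolynomial (Fin n) k) : MvPowerSeries (Fin n) k) =
        q * (MvPolynomial.pderiv i p : MvPolynomial (Fin n) k) -
          (MvPolynomial.pderiv i q : MvPolynomial (Fin n) k) * p := by
      simp only [← MvPolynomial.coeToMvPowerSeries.ringHom_apply, map_sub, map_mul]
    rw [h1, ← h, ← hf]
    push_cast
    ring

/-- The ring `k[[x]]` of all formal power series. -/
def formal : CoeffRing k n where
  toSubalgebra := ⊤
  pderiv_mem := fun _ _ _ => trivial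

/-- The number of exponents below a given one. -/
theorem card_antidiagonal_le (α : Fin n →₀ ℕ) :
    ((Finset.HasAntidiagonal.antidiagonal α).card : ℝ) ≤ 2 ^ α.degree := by
  have h1 : (Finset.HasAntidiagonal.antidiagonal α).card ≤ (Finset.Iic α).card := by
    refine Finset.card_le_card_of_injOn Prod.fst (fun x hx => ?_) (fun x hx y hy h => ?_)
    · rw [Finset.mem_coe, Finset.HasAntidiagonal.mem_antidiagonal] at hx
      simpa using hx ▸ le_self_add
    · rw [Finset.mem_coe, Finset.HasAntidiagonal.mem_antidiagonal] at hx hy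
      rw [← hy, h] at hx
      exact Prod.ext h (add_left_cancel hx)
  have h2 : (Finset.Iic α).card ≤ 2 ^ α.degree := by
    rw [Finsupp.card_Iic, Finsupp.degree_apply, ← Finset.prod_pow_eq_pow_sum]
    refine Finset.prod_le_prod' fun i _ => ?_
    simpa using Nat.lt_two_pow_self
  exact_mod_cast h1.trans h2

/-- The ring `ℂ{x}` of germs at `0` of analytic functions, inside `ℂ[[x]]`: the power series that
converge in a neighbourhood of the origin, that is, whose coefficients `c_α` are bounded by
`M R^|α|` for some constants `M` and `R`. -/
def analytic : CoeffRing ℂ n where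
  carrier := {f | ∃ M R : ℝ, 0 ≤ R ∧
    ∀ α : Fin n →₀ ℕ, ‖MvPowerSeries.coeff α f‖ ≤ M * R ^ α.degree}
  mul_mem' := by
    rintro f g ⟨M, R, hR, hf⟩ ⟨M', R', hR', hg⟩
    have hM : 0 ≤ M := by simpa using (norm_nonneg _).trans (hf 0)
    have hM' : 0 ≤ M' := by simpa using (norm_nonneg _).trans (hg 0)
    have hm : 0 ≤ max R R' := hR.trans (le_max_left _ _)
    refine ⟨M * M', 2 * max R R', by positivity, fun α => ?_⟩
    classical
    rw [MvPowerSeries.coeff_mul]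
    refine (norm_sum_le _ _).trans ?_
    have h : ∀ x ∈ Finset.HasAntidiagonal.antidiagonal α,
        ‖MvPowerSeries.coeff x.1 f * MvPowerSeries.coeff x.2 g‖ ≤
          M * M' * max R R' ^ α.degree := by
      intro x hx
      rw [Finset.HasAntidiagonal.mem_antidiagonal] at hx
      rw [norm_mul, ← hx, map_add, pow_add]
      calc ‖MvPowerSeries.coeff x.1 f‖ * ‖MvPowerSeries.coeff x.2 g‖
          ≤ (M * R ^ x.1.degree) * (M' * R' ^ x.2.degree) := by
            gcongr
            · exact hf _
            · exact hg _
        _ ≤ (M * max R R' ^ x.1.degree) * (M' * max R R' ^ x.2.degree) := by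
            gcongr
            · exact le_max_left _ _
            · exact le_max_right _ _
        _ = _ := by ring
    refine (Finset.sum_le_card_nsmul _ _ _ h).trans ?_
    rw [nsmul_eq_mul, mul_pow]
    calc ((Finset.HasAntidiagonal.antidiagonal α).card : ℝ) * (M * M' * max R R' ^ α.degree)
        ≤ 2 ^ α.degree * (M * M' * max R R' ^ α.degree) := by
          gcongr
          exact card_antidiagonal_le n α
      _ = _ := by ring
  add_mem' := by
    rintro f g ⟨M, R, hR, hf⟩ ⟨M', R', hR', hg⟩
    have hM : 0 ≤ M := by simpa using (norm_nonneg _).trans (hf 0)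
    have hM' : 0 ≤ M' := by simpa using (norm_nonneg _).trans (hg 0)
    refine ⟨M + M', max R R', hR.trans (le_max_left _ _), fun α => ?_⟩
    rw [map_add, add_mul]
    refine (norm_add_le _ _).trans (add_le_add ((hf α).trans ?_) ((hg α).trans ?_))
    · gcongr
      exact le_max_left _ _
    · gcongr
      exact le_max_right _ _
  algebraMap_mem' := by
    intro c
    refine ⟨‖c‖, 0, le_rfl, fun α => ?_⟩
    classical
    rw [MvPowerSeries.algebraMap_apply, MvPowerSeries.coeff_C]
    split_ifs with h
    · simp [h]
    · simp only [norm_zero]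
      positivity
  pderiv_mem := by
    rintro i f ⟨M, R, hR, hf⟩
    have hM : 0 ≤ M := by simpa using (norm_nonneg _).trans (hf 0)
    refine ⟨M * R, 2 * R, by positivity, fun α => ?_⟩
    have h1 : ((α i : ℝ) + 1) ≤ 2 ^ α.degree := by
      have : α i + 1 ≤ 2 ^ α.degree :=
        (Nat.succ_le_succ (Finsupp.le_degree i α)).trans Nat.lt_two_pow_self
      exact_mod_cast this
    have h2 : ‖((α i : ℂ) + 1)‖ = (α i : ℝ) + 1 := by
      rw [← Nat.cast_succ, Complex.norm_natCast, Nat.cast_succ]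
    rw [MvPowerSeries.coeff_pderiv, norm_mul, h2]
    calc ‖MvPowerSeries.coeff (α + Finsupp.single i 1) f‖ * ((α i : ℝ) + 1)
        ≤ (M * R ^ (α + Finsupp.single i 1).degree) * 2 ^ α.degree := by
          gcongr
          exact hf _
      _ = _ := by
          rw [map_add, Finsupp.degree_single, pow_succ, mul_pow]
          ring

variable {k n}

theorem poly_le_alg : (poly k n).toSubalgebra ≤ (alg k n).toSubalgebra := by
  rintro _ ⟨p, rfl⟩
  exact ⟨p, 1, by simp, by simp⟩

theorem alg_le_formal : (alg k n).toSubalgebra ≤ (formal k n).toSubalgebra := le_top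

theorem alg_le_analytic : (alg ℂ n).toSubalgebra ≤ (analytic n).toSubalgebra := by
  classical
  rintro f ⟨p, q, hq, hf⟩
  set c : ℝ := ‖MvPolynomial.constantCoeff q‖ with hc
  have hc0 : 0 < c := norm_pos_iff.2 hq
  set K : ℝ := ∑ b ∈ q.support, ‖q.coeff b‖ with hK
  set N : ℝ := ∑ b ∈ p.support, ‖p.coeff b‖ with hN
  have hK0 : 0 ≤ K := Finset.sum_nonneg fun _ _ => norm_nonneg _
  have hN0 : 0 ≤ N := Finset.sum_nonneg fun _ _ => norm_nonneg _
  set R : ℝ := max 1 (2 * K / c) with hR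
  have hR1 : 1 ≤ R := le_max_left _ _
  have hR0 : 0 < R := by linarith
  have hRK : K / R ≤ c / 2 := by
    have : 2 * K / c ≤ R := le_max_right _ _
    rw [div_le_iff₀ hc0] at this
    rw [div_le_iff₀ hR0]
    linarith
  refine ⟨2 * N / c, R, hR0.le, ?_⟩
  set M : ℝ := 2 * N / c with hM
  have hM0 : 0 ≤ M := by positivity
  suffices h : ∀ d : ℕ, ∀ α : Fin n →₀ ℕ, α.degree = d →
      ‖MvPowerSeries.coeff α f‖ ≤ M * R ^ α.degree from fun α => h _ α rfl
  intro d
  induction d using Nat.strong_induction_on with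
  | _ d ih =>
  intro α hα
  have key : MvPolynomial.constantCoeff q * MvPowerSeries.coeff α f =
      p.coeff α - ∑ x ∈ (Finset.HasAntidiagonal.antidiagonal α).erase (0, α),
        q.coeff x.1 * MvPowerSeries.coeff x.2 f := by
    have h := congrArg (MvPowerSeries.coeff α) hf
    rw [MvPowerSeries.coeff_mul, ← Finset.add_sum_erase _ _
      (show (0, α) ∈ Finset.HasAntidiagonal.antidiagonal α by simp)] at h
    simp only [MvPolynomial.coeff_coe] at h
    rw [← h, MvPolynomial.constantCoeff_eq]
    ring
  have hp : ‖p.coeff α‖ ≤ N := by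
    by_cases hs : α ∈ p.support
    · exact Finset.single_le_sum (f := fun b => ‖p.coeff b‖) (fun _ _ => norm_nonneg _) hs
    · rw [MvPolynomial.notMem_support_iff.1 hs, norm_zero]
      exact hN0
  have hterm : ∀ x ∈ (Finset.HasAntidiagonal.antidiagonal α).erase (0, α),
      ‖q.coeff x.1 * MvPowerSeries.coeff x.2 f‖ ≤ ‖q.coeff x.1‖ * (M * R ^ α.degree / R) := by
    intro x hx
    rw [Finset.mem_erase, Finset.HasAntidiagonal.mem_antidiagonal] at hx
    have hx1 : x.1 ≠ 0 := by
      intro h0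
      refine hx.1 (Prod.ext h0 ?_)
      rw [← hx.2, h0, zero_add]
    have hdeg : x.1.degree + x.2.degree = α.degree := by rw [← hx.2, map_add]
    have hpos : 0 < x.1.degree := Nat.pos_of_ne_zero fun h =>
      hx1 ((Finsupp.degree_eq_zero_iff _).1 h)
    rw [norm_mul]
    gcongr
    refine (ih x.2.degree (by omega) x.2 rfl).trans ?_
    rw [mul_div_assoc]
    gcongr
    rw [le_div_iff₀ hR0, ← pow_succ]
    exact pow_le_pow_right₀ hR1 (by omega)
  have hsum : ∑ x ∈ (Finset.HasAntidiagonal.antidiagonal α).erase (0, α), ‖q.coeff x.1‖ ≤ K := by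
    have hinj : Set.InjOn Prod.fst
        (((Finset.HasAntidiagonal.antidiagonal α).erase (0, α) : Finset _) : Set ((Fin n →₀ ℕ) × (Fin n →₀ ℕ))) := by
      intro x hx y hy h
      rw [Finset.mem_coe, Finset.mem_erase, Finset.HasAntidiagonal.mem_antidiagonal] at hx hy
      have h' := hx.2.trans hy.2.symm
      rw [h] at h'
      exact Prod.ext h (add_left_cancel h')
    rw [← Finset.sum_image (f := fun b => ‖q.coeff b‖) hinj, hK]
    rw [← Finset.sum_filter_ne_zero]
    refine Finset.sum_le_sum_of_subset_of_nonneg (fun b hb => ?_) fun _ _ _ => norm_nonneg _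
    rw [Finset.mem_filter] at hb
    exact MvPolynomial.mem_support_iff.2 (norm_ne_zero_iff.1 hb.2)
  have hfin : c * ‖MvPowerSeries.coeff α f‖ ≤ c * (M * R ^ α.degree) := by
    have hRα : 1 ≤ R ^ α.degree := one_le_pow₀ hR1
    calc c * ‖MvPowerSeries.coeff α f‖
        = ‖p.coeff α - ∑ x ∈ (Finset.HasAntidiagonal.antidiagonal α).erase (0, α),
            q.coeff x.1 * MvPowerSeries.coeff x.2 f‖ := by rw [hc, ← norm_mul, key]
      _ ≤ N + ∑ x ∈ (Finset.HasAntidiagonal.antidiagonal α).erase (0, α),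
            ‖q.coeff x.1‖ * (M * R ^ α.degree / R) := by
          refine (norm_sub_le _ _).trans (add_le_add hp ?_)
          exact (norm_sum_le _ _).trans (Finset.sum_le_sum hterm)
      _ ≤ N + K * (M * R ^ α.degree / R) := by
          rw [← Finset.sum_mul]
          gcongr
      _ = c / 2 * M + K / R * (M * R ^ α.degree) := by
          rw [hM]
          field_simp
      _ ≤ c / 2 * (M * R ^ α.degree) + c / 2 * (M * R ^ α.degree) := by
          gcongr
          exact le_mul_of_one_le_right hM0 hRα
      _ = _ := by ring
  exact le_of_mul_le_mul_left hfin hc0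

theorem analytic_le_formal : (analytic n).toSubalgebra ≤ (formal ℂ n).toSubalgebra := le_top

end CoeffRing

end Coefficients

/-! ### Differential operators with coefficients in a subring -/

namespace DiffOp

variable {B : Type*} [CommRing B] {n : ℕ} {Δ : CommDer B n}

theorem lcoef_apply (a : B) (P : DiffOp Δ) :
    lcoef Δ a P = ∑ β ∈ supp P, mono Δ β (a * coeff β P) := by
  conv_lhs => rw [← sum_mono P, map_sum]
  exact Finset.sum_congr rfl fun β _ => lcoef_mono _ _ _

theorem lpartial_apply (i : Fin n) (P : DiffOp Δ) :
    lpartial Δ i P = ∑ β ∈ supp P,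
      (mono Δ (β + Finsupp.single i 1) (coeff β P) + mono Δ β (Δ.der i (coeff β P))) := by
  conv_lhs => rw [← sum_mono P, map_sum]
  exact Finset.sum_congr rfl fun β _ => lpartial_mono _ _ _

/-- The operators all of whose coefficients lie in given additive subgroups. -/
def coefAddSubgroup (Δ : CommDer B n) (A : (Fin n →₀ ℕ) → AddSubgroup B) :
    AddSubgroup (DiffOp Δ) :=
  ⨅ β, (A β).comap (coeff β)

theorem mem_coefAddSubgroup {A : (Fin n →₀ ℕ) → AddSubgroup B} {P : DiffOp Δ} :
    P ∈ coefAddSubgroup Δ A ↔ ∀ β, coeff β P ∈ A β := by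
  simp [coefAddSubgroup, AddSubgroup.mem_iInf]

theorem mono_mem_coef {A : (Fin n →₀ ℕ) → AddSubgroup B} {β : Fin n →₀ ℕ} {b : B}
    (h : b ∈ A β) : mono Δ β b ∈ coefAddSubgroup Δ A := by
  rw [mem_coefAddSubgroup]
  intro γ
  rw [coeff_mono]
  split_ifs with hγ
  · exact hγ ▸ h
  · exact zero_mem _

/-- The subring of the operators whose coefficients lie in a subring `A` of `B` that is closed
under the derivations. -/
def coefSubring (Δ : CommDer B n) (A : Subring B) (hA : ∀ i, ∀ b ∈ A, Δ.der i b ∈ A) :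
    Subring (DiffOp Δ) where
  __ := coefAddSubgroup Δ fun _ => A.toAddSubgroup
  one_mem' := mono_mem_coef A.one_mem
  mul_mem' := by
    intro P Q hP hQ
    have hP : ∀ β, coeff β P ∈ A := mem_coefAddSubgroup.1 hP
    let S : Subsemiring (Module.End ℤ (DiffOp Δ)) :=
      { carrier := {T | ∀ Q ∈ coefAddSubgroup Δ fun _ => A.toAddSubgroup,
          T Q ∈ coefAddSubgroup Δ fun _ => A.toAddSubgroup}
        mul_mem' := fun {T U} hT hU Q hQ => hT _ (hU _ hQ)
        one_mem' := fun Q hQ => hQ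
        add_mem' := fun {T U} hT hU Q hQ => add_mem (hT _ hQ) (hU _ hQ)
        zero_mem' := fun Q _ => zero_mem _ }
    refine lmul_mem S P (fun β Q hQ => ?_) (fun i Q hQ => ?_) Q hQ
    · rw [mem_coefAddSubgroup] at hQ
      rw [lcoef_apply]
      exact sum_mem fun γ _ => mono_mem_coef (A.mul_mem (hP β) (hQ γ))
    · rw [mem_coefAddSubgroup] at hQ
      rw [lpartial_apply]
      exact sum_mem fun γ _ => add_mem (mono_mem_coef (hQ γ)) (mono_mem_coef (hA i _ (hQ γ)))

theorem mem_coefSubring {A : Subring B} {hA : ∀ i, ∀ b ∈ A, Δ.der i b ∈ A} {P : DiffOp Δ} :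
    P ∈ coefSubring Δ A hA ↔ ∀ β, coeff β P ∈ A :=
  mem_coefAddSubgroup

end DiffOp

/-! ### The rings `D` and `h(D)` -/

section Operators

variable (k : Type*) [Field k] (n : ℕ)

/-- The derivations `∂/∂xᵢ` of `k[[x]]`. -/
def derO : CommDer (MvPowerSeries (Fin n) k) n where
  der i := (MvPowerSeries.pderiv k i).toLinearMap.toAddMonoidHom
  leibniz i f g := by
    change MvPowerSeries.pderiv k i (f * g) =
      f * MvPowerSeries.pderiv k i g + MvPowerSeries.pderiv k i f * g
    rw [Derivation.leibniz, smul_eq_mul, smul_eq_mul, mul_comm g]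
  comm := by
    intro i j f
    ext α
    change MvPowerSeries.coeff α (MvPowerSeries.pderiv k i (MvPowerSeries.pderiv k j f)) =
      MvPowerSeries.coeff α (MvPowerSeries.pderiv k j (MvPowerSeries.pderiv k i f))
    simp only [MvPowerSeries.coeff_pderiv]
    rcases eq_or_ne i j with rfl | hij
    · rfl
    · rw [add_right_comm]
      simp [Finsupp.single_eq_of_ne hij, Finsupp.single_eq_of_ne hij.symm]
      ring

theorem derO_apply (i : Fin n) (f : MvPowerSeries (Fin n) k) :
    (derO k n).der i f = MvPowerSeries.pderiv k i f := rfl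

/-- The map `h · ∂/∂xᵢ : ∑ f_m h^m ↦ ∑ (∂f_m/∂xᵢ) h^(m+1)` of `k[[x]][h]`. -/
def hpartial (i : Fin n) (p : Polynomial (MvPowerSeries (Fin n) k)) :
    Polynomial (MvPowerSeries (Fin n) k) :=
  ∑ m ∈ p.support, Polynomial.monomial (m + 1) (MvPowerSeries.pderiv k i (p.coeff m))

theorem hpartial_coeff_zero (i : Fin n) (p : Polynomial (MvPowerSeries (Fin n) k)) :
    (hpartial k n i p).coeff 0 = 0 := by
  simp [hpartial, Polynomial.coeff_monomial]

theorem hpartial_coeff_succ (i : Fin n) (p : Polynomial (MvPowerSeries (Fin n) k)) (m : ℕ) :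
    (hpartial k n i p).coeff (m + 1) = MvPowerSeries.pderiv k i (p.coeff m) := by
  simp only [hpartial, Polynomial.finsetSum_coeff, Polynomial.coeff_monomial, add_left_inj,
    Finset.sum_ite_eq']
  split_ifs with h
  · rfl
  · rw [Polynomial.notMem_support_iff.1 h, map_zero]

/-- The derivations `h · ∂/∂xᵢ` of `k[[x]][h]`, where `h` is the polynomial variable and
`∂/∂xᵢ` acts on the coefficients. -/
def derH : CommDer (Polynomial (MvPowerSeries (Fin n) k)) n where
  der i := AddMonoidHom.mk' (hpartial k n i) (by
    intro p q
    ext1 m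
    cases m with
    | zero => simp [hpartial_coeff_zero]
    | succ m => simp [hpartial_coeff_succ])
  leibniz i p q := by
    change hpartial k n i (p * q) = p * hpartial k n i q + hpartial k n i p * q
    ext1 m
    cases m with
    | zero => simp [hpartial_coeff_zero, Polynomial.mul_coeff_zero]
    | succ m =>
      rw [hpartial_coeff_succ, Polynomial.coeff_add, Polynomial.coeff_mul, Polynomial.coeff_mul,
        Polynomial.coeff_mul, map_sum,
        Finset.Nat.sum_antidiagonal_succ' (f := fun x => p.coeff x.1 * (hpartial k n i q).coeff x.2),
        Finset.Nat.sum_antidiagonal_succ (f := fun x => (hpartial k n i p).coeff x.1 * q.coeff x.2),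
        hpartial_coeff_zero, hpartial_coeff_zero, mul_zero,
        zero_mul, zero_add, zero_add, ← Finset.sum_add_distrib]
      refine Finset.sum_congr rfl fun x _ => ?_
      rw [hpartial_coeff_succ, hpartial_coeff_succ, Derivation.leibniz, smul_eq_mul, smul_eq_mul,
        mul_comm (q.coeff _)]
  comm i j p := by
    change hpartial k n i (hpartial k n j p) = hpartial k n j (hpartial k n i p)
    ext1 m
    rcases m with _ | _ | m
    · simp [hpartial_coeff_zero]
    · simp [hpartial_coeff_zero, hpartial_coeff_succ]
    · simp only [hpartial_coeff_succ]
      exact (derO k n).comm i j _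

theorem derH_apply (i : Fin n) (p : Polynomial (MvPowerSeries (Fin n) k)) :
    (derH k n).der i p = hpartial k n i p := rfl

variable {k n}

/-- `D`: the differential operators `∑ c_β ∂^β` with coefficients in `C`. -/
def D (C : CoeffRing k n) : Subring (DiffOp (derO k n)) :=
  DiffOp.coefSubring (derO k n) C.toSubalgebra.toSubring fun i _ h => C.pderiv_mem i h

/-- The polynomials in `h` with coefficients in `C`. -/
def hCoef (C : CoeffRing k n) : Subring (Polynomial (MvPowerSeries (Fin n) k)) where
  carrier := {p | ∀ m, p.coeff m ∈ C.toSubalgebra}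
  mul_mem' := by
    intro p q hp hq m
    rw [Polynomial.coeff_mul]
    exact sum_mem fun x _ => mul_mem (hp _) (hq _)
  one_mem' := by
    intro m
    rw [Polynomial.coeff_one]
    split_ifs
    · exact one_mem _
    · exact zero_mem _
  add_mem' := by
    intro p q hp hq m
    rw [Polynomial.coeff_add]
    exact add_mem (hp m) (hq m)
  zero_mem' := fun m => by
    rw [Polynomial.coeff_zero]
    exact zero_mem _
  neg_mem' := by
    intro p hp m
    rw [Polynomial.coeff_neg]
    exact neg_mem (hp m)

/-- `h(D)`: the homogenized ring generated by `C`, the `∂ᵢ` and a central variable `h` subject to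
`∂ᵢ c - c ∂ᵢ = (∂c/∂xᵢ) h`, whose elements are the `∑ c_{β,m} ∂^β h^m` with `c_{β,m} ∈ C`. -/
def hD (C : CoeffRing k n) : Subring (DiffOp (derH k n)) :=
  DiffOp.coefSubring (derH k n) (hCoef C) (by
    intro i p hp m
    rw [derH_apply]
    cases m with
    | zero =>
      rw [hpartial_coeff_zero]
      exact zero_mem _
    | succ m =>
      rw [hpartial_coeff_succ]
      exact C.pderiv_mem i (hp m))

theorem mem_D {C : CoeffRing k n} {P : DiffOp (derO k n)} :
    P ∈ D C ↔ ∀ β, DiffOp.coeff β P ∈ C.toSubalgebra := DiffOp.mem_coefSubring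

theorem mem_hD {C : CoeffRing k n} {P : DiffOp (derH k n)} :
    P ∈ hD C ↔ ∀ β m, (DiffOp.coeff β P).coeff m ∈ C.toSubalgebra := DiffOp.mem_coefSubring

variable {C C' : CoeffRing k n}

theorem D_mono (h : C.toSubalgebra ≤ C'.toSubalgebra) : D C ≤ D C' :=
  fun _ hP => mem_D.2 fun β => h (mem_D.1 hP β)

theorem hD_mono (h : C.toSubalgebra ≤ C'.toSubalgebra) : hD C ≤ hD C' :=
  fun _ hP => mem_hD.2 fun β m => h (mem_hD.1 hP β m)

/-- The inclusion `D ⊆ D'` for `C ⊆ C'`. -/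
def Dincl (h : C.toSubalgebra ≤ C'.toSubalgebra) : D C →+* D C' :=
  Subring.inclusion (D_mono h)

/-- The inclusion `h(D) ⊆ h(D')` for `C ⊆ C'`. -/
def hDincl (h : C.toSubalgebra ≤ C'.toSubalgebra) : hD C →+* hD C' :=
  Subring.inclusion (hD_mono h)

theorem Dincl_val (h : C.toSubalgebra ≤ C'.toSubalgebra) (P : D C) :
    (Dincl h P).1 = P.1 := Subring.coe_inclusion (D_mono h) P

theorem hDincl_val (h : C.toSubalgebra ≤ C'.toSubalgebra) (P : hD C) :
    (hDincl h P).1 = P.1 := Subring.coe_inclusion (hD_mono h) P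

/-! ### Homogenization -/

/-- The degree of a differential operator: the maximum of the `|β|` such that `∂^β` occurs. -/
def deg (P : DiffOp (derO k n)) : ℕ := (DiffOp.supp P).sup Finsupp.degree

/-- The homogenization `∑ c_β ∂^β h^(d - |β|)` of `P = ∑ c_β ∂^β`, where `d` is the degree
of `P`. -/
def homog (P : DiffOp (derO k n)) : DiffOp (derH k n) :=
  ∑ β ∈ DiffOp.supp P, DiffOp.mono (derH k n) β
    (Polynomial.monomial (deg P - β.degree) (DiffOp.coeff β P))

/-- The homogenization of an operator with coefficients in `C`. -/
def hElem (P : D C) : hD C :=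
  ⟨homog P.1, sum_mem fun β _ => DiffOp.mono_mem_coef fun m => by
    rw [Polynomial.coeff_monomial]
    split_ifs
    · exact mem_D.1 P.2 β
    · exact zero_mem _⟩

/-- The homogenization of a left ideal `I` of `D`: the left ideal of `h(D)` generated by the
homogenizations of the elements of `I`. -/
def hIdeal (I : Ideal (D C)) : Ideal (hD C) := Ideal.span (hElem '' (I : Set (D C)))

/-! ### The filtration given by a weight vector, and initial ideals -/

variable (n) in
/-- The local weight vectors `w = (u, v)`, those with `uᵢ ≤ 0` and `uᵢ + vᵢ ≥ 0` for all `i`. -/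
def Wloc : Set ((Fin n → ℝ) × (Fin n → ℝ)) := {w | ∀ i, w.1 i ≤ 0 ∧ 0 ≤ w.1 i + w.2 i}

/-- The weight `u · α`. -/
def dot (u : Fin n → ℝ) (α : Fin n →₀ ℕ) : ℝ := ∑ i, u i * α i

theorem dot_add (u : Fin n → ℝ) (α β : Fin n →₀ ℕ) : dot u (α + β) = dot u α + dot u β := by
  simp [dot, mul_add, Finset.sum_add_distrib]

theorem dot_zero (u : Fin n → ℝ) : dot u 0 = 0 := by simp [dot]

theorem dot_single (u : Fin n → ℝ) (i : Fin n) : dot u (Finsupp.single i 1) = u i := by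
  classical
  simp [dot, Finsupp.single_apply]

/-- The support of `P = ∑ c_{α,β,m} x^α ∂^β h^m`: the set of the `(α, β, m)` with
`c_{α,β,m} ≠ 0`. -/
def support (P : DiffOp (derH k n)) : Set ((Fin n →₀ ℕ) × (Fin n →₀ ℕ) × ℕ) :=
  {e | MvPowerSeries.coeff e.1 ((DiffOp.coeff e.2.1 P).coeff e.2.2) ≠ 0}

/-- The polynomials in `h` over `k[[x]]` all of whose monomials `x^α h^m` have
`u · α ≤ r`. -/
def coefStep (u : Fin n → ℝ) (r : ℝ) : AddSubgroup (Polynomial (MvPowerSeries (Fin n) k)) where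
  carrier := {p | ∀ m α, MvPowerSeries.coeff α (p.coeff m) ≠ 0 → dot u α ≤ r}
  add_mem' := by
    intro p q hp hq m α h
    rw [Polynomial.coeff_add, map_add] at h
    by_cases h1 : MvPowerSeries.coeff α (p.coeff m) = 0
    · rw [h1, zero_add] at h
      exact hq m α h
    · exact hp m α h1
  zero_mem' := fun m α h => by simp at h
  neg_mem' := by
    intro p hp m α h
    rw [Polynomial.coeff_neg, map_neg, neg_ne_zero] at h
    exact hp m α h

theorem coefStep_mono (u : Fin n → ℝ) {r s : ℝ} (h : r ≤ s) {p} (hp : p ∈ coefStep (k := k) u r) :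
    p ∈ coefStep (k := k) u s := fun m α hα => (hp m α hα).trans h

theorem coefStep_mul (u : Fin n → ℝ) {r s : ℝ} {p q} (hp : p ∈ coefStep (k := k) u r)
    (hq : q ∈ coefStep (k := k) u s) : p * q ∈ coefStep (k := k) u (r + s) := by
  classical
  intro m α h
  rw [Polynomial.coeff_mul, map_sum] at h
  obtain ⟨x, -, hx⟩ := Finset.exists_ne_zero_of_sum_ne_zero h
  rw [MvPowerSeries.coeff_mul] at hx
  obtain ⟨y, hy, hxy⟩ := Finset.exists_ne_zero_of_sum_ne_zero hx
  rw [Finset.HasAntidiagonal.mem_antidiagonal] at hy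
  rw [← hy, dot_add]
  exact add_le_add (hp _ _ (left_ne_zero_of_mul hxy)) (hq _ _ (right_ne_zero_of_mul hxy))

theorem coefStep_hpartial (u : Fin n → ℝ) {r : ℝ} {p} (hp : p ∈ coefStep (k := k) u r)
    (i : Fin n) : hpartial k n i p ∈ coefStep (k := k) u (r - u i) := by
  intro m α h
  cases m with
  | zero => simp [hpartial_coeff_zero] at h
  | succ m =>
    rw [hpartial_coeff_succ, MvPowerSeries.coeff_pderiv] at h
    have := hp _ _ (left_ne_zero_of_mul h)
    rw [dot_add, dot_single] at this
    linarith

/-- The additive group of the operators `P` all of whose monomials `x^α ∂^β h^m` have weight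
`u · α + v · β ≤ r` (the variable `h` has weight `0`). -/
def step (w : (Fin n → ℝ) × (Fin n → ℝ)) (r : ℝ) : AddSubgroup (DiffOp (derH k n)) :=
  DiffOp.coefAddSubgroup (derH k n) fun β => coefStep w.1 (r - dot w.2 β)

theorem mem_step {w : (Fin n → ℝ) × (Fin n → ℝ)} {r : ℝ} {P : DiffOp (derH k n)} :
    P ∈ step w r ↔ ∀ e ∈ support P, dot w.1 e.1 + dot w.2 e.2.1 ≤ r := by
  rw [step, DiffOp.mem_coefAddSubgroup]
  refine ⟨fun h e he => ?_, fun h β m α hα => ?_⟩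
  · have := h e.2.1 e.2.2 e.1 he
    linarith
  · have := h (α, β, m) hα
    simp only at this
    linarith

theorem step_mono (w : (Fin n → ℝ) × (Fin n → ℝ)) {r s : ℝ} (h : r ≤ s) :
    step (k := k) w r ≤ step w s := fun _ hP =>
  mem_step.2 fun e he => (mem_step.1 hP e he).trans h

theorem mono_mem_step {w : (Fin n → ℝ) × (Fin n → ℝ)} {r : ℝ} {β : Fin n →₀ ℕ} {p}
    (hp : p ∈ coefStep (k := k) w.1 (r - dot w.2 β)) : DiffOp.mono (derH k n) β p ∈ step w r :=
  DiffOp.mono_mem_coef hp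

theorem lcoef_mem_step {w : (Fin n → ℝ) × (Fin n → ℝ)} {r s : ℝ} {p}
    {Q : DiffOp (derH k n)} (hp : p ∈ coefStep (k := k) w.1 r) (hQ : Q ∈ step w s) :
    DiffOp.lcoef _ p Q ∈ step w (r + s) := by
  rw [DiffOp.lcoef_apply]
  refine sum_mem fun β _ => mono_mem_step ?_
  rw [add_sub_assoc]
  exact coefStep_mul _ hp (DiffOp.mem_coefAddSubgroup.1 hQ β)

theorem lpartial_mem_step {w : (Fin n → ℝ) × (Fin n → ℝ)} (hw : w ∈ Wloc n) {s : ℝ}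
    {Q : DiffOp (derH k n)} (hQ : Q ∈ step w s) (i : Fin n) :
    DiffOp.lpartial _ i Q ∈ step w (w.2 i + s) := by
  rw [DiffOp.lpartial_apply]
  refine sum_mem fun β _ => ?_
  have hβ := DiffOp.mem_coefAddSubgroup.1 hQ β
  refine add_mem (mono_mem_step (coefStep_mono _ (le_of_eq ?_) hβ))
    (mono_mem_step (coefStep_mono _ ?_ (coefStep_hpartial _ hβ i)))
  · rw [dot_add, dot_single]
    ring
  · have := (hw i).2
    linarith

theorem lpow_mem_step {w : (Fin n → ℝ) × (Fin n → ℝ)} (hw : w ∈ Wloc n) {s : ℝ}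
    {Q : DiffOp (derH k n)} (hQ : Q ∈ step w s) (β : Fin n →₀ ℕ) :
    DiffOp.lpow _ β Q ∈ step w (dot w.2 β + s) := by
  induction β using DiffOp.induction_add_single with
  | zero =>
    rw [DiffOp.lpow_zero, dot_zero, zero_add]
    exact hQ
  | add β i ih =>
    rw [DiffOp.lpow_add_single, Module.End.mul_apply, dot_add, dot_single,
      add_comm (dot w.2 β), add_assoc]
    exact lpartial_mem_step hw ih i

theorem mul_mem_step {w : (Fin n → ℝ) × (Fin n → ℝ)} (hw : w ∈ Wloc n) {r s : ℝ}
    {P Q : DiffOp (derH k n)} (hP : P ∈ step w r) (hQ : Q ∈ step w s) :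
    P * Q ∈ step w (r + s) := by
  rw [DiffOp.mul_def, DiffOp.lmul, LinearMap.sum_apply]
  refine sum_mem fun β _ => ?_
  have h := lcoef_mem_step (DiffOp.mem_coefAddSubgroup.1 hP β) (lpow_mem_step hw hQ β)
  rwa [show r - dot w.2 β + (dot w.2 β + s) = r + s by ring] at h

/-- The filtration of `h(D)` by the order with respect to a local weight vector:
`F_r = {P | ord^w(P) ≤ r}`. -/
def filt (w : Wloc n) (C : CoeffRing k n) : RingFiltration (hD C) where
  F r := (step w.1 r).comap (hD C).subtype.toAddMonoidHom
  mono := fun _ _ h _ hP => step_mono w.1 h hP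
  one_mem := by
    change (1 : DiffOp (derH k n)) ∈ step w.1 0
    rw [DiffOp.one_def]
    refine mono_mem_step fun m α h => ?_
    classical
    rw [Polynomial.coeff_one] at h
    split_ifs at h
    · rw [MvPowerSeries.coeff_one] at h
      split_ifs at h with hα
      · simp [hα, dot_zero]
      · exact absurd rfl h
    · simp at h
  mul_mem := fun ha hb => mul_mem_step w.2 ha hb

theorem mem_filt {w : Wloc n} {C : CoeffRing k n} {r : ℝ} {P : hD C} :
    P ∈ (filt w C).F r ↔ ∀ e ∈ support P.1, dot w.1.1 e.1 + dot w.1.2 e.2.1 ≤ r :=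
  mem_step (w := w.1) (P := P.1)

theorem hDincl_mem_filt {w : Wloc n} (h : C.toSubalgebra ≤ C'.toSubalgebra) {r : ℝ} {P : hD C}
    (hP : P ∈ (filt w C).F r) : hDincl h P ∈ (filt w C').F r := by
  rw [mem_filt] at hP ⊢
  rw [hDincl_val]
  exact hP

/-- The order `ord^w(P)`: the maximum of the weights of the monomials of `P`. -/
def ord (w : Wloc n) (P : hD C) : ℝ :=
  sSup ((fun e => dot w.1.1 e.1 + dot w.1.2 e.2.1) '' support P.1)

theorem mem_filt_ord (w : Wloc n) (P : hD C) : P ∈ (filt w C).F (ord w P) := by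
  rw [mem_filt]
  refine fun e he => le_csSup ?_ ⟨e, he, rfl⟩
  obtain ⟨M, hM⟩ := ((DiffOp.supp P.1).finite_toSet.image (dot w.1.2)).bddAbove
  refine ⟨M, ?_⟩
  rintro _ ⟨e, he, rfl⟩
  have h1 : dot w.1.1 e.1 ≤ 0 :=
    Finset.sum_nonpos fun i _ => mul_nonpos_of_nonpos_of_nonneg (w.2 i).1 (Nat.cast_nonneg _)
  have h2 : dot w.1.2 e.2.1 ≤ M := by
    refine hM ⟨e.2.1, DiffOp.mem_supp.2 fun h => he ?_, rfl⟩
    rw [h, Polynomial.coeff_zero, map_zero]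
  simp only
  linarith

/-- The initial form `in_w(P)`: the class of `P` in `F_r / F_{<r}` for `r = ord^w(P)`. -/
def inForm (w : Wloc n) (P : hD C) : (filt w C).Gr :=
  (filt w C).symb (ord w P) ⟨P, mem_filt_ord w P⟩

/-- The initial ideal `in_w(J)`: the left ideal of `gr^w(h(D))` generated by the initial forms of
the elements of `J`. -/
def inIdeal (w : Wloc n) (J : Ideal (hD C)) : Ideal (filt w C).Gr :=
  Ideal.span (inForm w '' (J : Set (hD C)))

/-- The canonical ring homomorphism `gr^w(h(D)) → gr^w(h(D'))` for `C ⊆ C'`. -/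
def grIncl (w : Wloc n) (h : C.toSubalgebra ≤ C'.toSubalgebra) :
    (filt w C).Gr →+* (filt w C').Gr :=
  RingFiltration.grMap (hDincl h) fun _ _ ha => hDincl_mem_filt h ha

end Operators
end LocalGroebner

end

open LocalGroebner

open scoped DirectSum

noncomputable section

namespace LocalGroebner

/-! ### Generic weights on exponents -/

section Weight

variable {n : ℕ}

/-! Both operations in the theorem, homogenizing and passing to initial forms, depend only on bounds
on the coefficients of an operator, and these bounds are linear conditions that descend along flat
extensions of the coefficients. No standard basis is needed.

Let `C ⊆ C'`. Since the `∂^β` (and `∂^β h^m`) span the operators over the coefficients, the left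
ideal generated by `I` over `C'` is the `C'`-span of `I` (`val_mem_span_of_mem_map`,
`mem_map_of_mem_span`). A degree bound says that certain coefficients vanish. Because `u ≤ 0`, a
bound on the order puts each coefficient of `∂^β h^m` into an ideal generated by finitely many
monomials, by Dickson's lemma. Requiring a combination `∑ f_j g_j` with `g_j ∈ I` to meet such
conditions is a finite linear system over `C` in the `f_j` and some auxiliary unknowns. If `C ⊆ C'`
is flat, the solutions over `C'` are combinations of solutions over `C`. This is
`LinFlat.mem_span_of_coordinates`: an element of the extended ideal with degree or order at most a
bound is a `C'`-combination of elements of the original ideal with the same bound.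

For homogenization (`map_hIdeal`), such a combination is homogenized term by term to one common
degree. For initial ideals (`map_inIdeal`), all terms lie in the filtration step of `P` and the
coefficients lie in `F_0`, so the symbol of `P` is the combination of the symbols of the terms.

It remains to prove flatness. Over the polynomials, the localization is treated by clearing
denominators, and the formal and convergent series by the lemma of Artin and Rees with Krull's
intersection theorem (`linFlat_of_isNoetherianRing`), which also gives convergent to formal series.
Flatness over the localization follows from flatness over the polynomials
(`linFlat_alg_of_linFlat_poly`). The convergent series must be shown to be noetherian with the
expected units; both follow from division with remainder for a generic positive weight
(`analytic_division`). -/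

theorem exists_pos_injective_dot (n : ℕ) :
    ∃ l : Fin n → ℝ, (∀ i, 0 < l i) ∧ Function.Injective (dot l) := by
  obtain ⟨s, hs, hli⟩ := Module.exists_set_linearIndependent_of_lt_rank (R := ℚ) (M := ℝ) (c := n) (by
    rw [Real.rank_rat_real]
    exact Cardinal.nat_lt_continuum n)
  obtain ⟨e⟩ : Nonempty (Fin n ≃ s) := by
    rw [← Cardinal.eq, hs, Cardinal.mk_fin]
  obtain ⟨μ, hμ⟩ : ∃ μ : Fin n → ℝ, LinearIndependent ℚ μ :=
    ⟨_, hli.comp e e.injective⟩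
  have h0 : ∀ i, μ i ≠ 0 := hμ.ne_zero
  refine ⟨fun i => |μ i|, fun i => abs_pos.2 (h0 i), fun α β h => ?_⟩
  -- The factor `±1` is the sign of `μ i`, so an equality of weights for `|μ|` becomes a rational
  -- relation between the `μ i` themselves.
  have key := Fintype.linearIndependent_iff.1 hμ
    (fun i => (if 0 < μ i then 1 else -1) * ((α i : ℚ) - β i)) (by
      have h' : ∑ i, (|μ i| * (α i : ℝ) - |μ i| * β i) = 0 := by
        rw [Finset.sum_sub_distrib]
        exact sub_eq_zero.2 h
      refine Eq.trans ?_ h'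
      refine Finset.sum_congr rfl fun i _ => ?_
      rw [Rat.smul_def]
      split_ifs with hi
      · rw [abs_of_pos hi]
        push_cast
        ring
      · rw [abs_of_nonpos (not_lt.1 hi)]
        push_cast
        ring)
  ext i
  have := key i
  have h2 : (α i : ℚ) - β i = 0 := by
    split_ifs at this <;> linarith
  exact_mod_cast sub_eq_zero.1 h2

variable {l : Fin n → ℝ}

theorem dot_nonneg (hl : ∀ i, 0 < l i) (α : Fin n →₀ ℕ) : 0 ≤ dot l α :=
  Finset.sum_nonneg fun i _ => mul_nonneg (hl i).le (Nat.cast_nonneg _)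

theorem dot_le_iff_finite (hl : ∀ i, 0 < l i) (s : ℝ) : {α : Fin n →₀ ℕ | dot l α ≤ s}.Finite := by
  refine (Set.finite_Iic (Finsupp.equivFunOnFinite.symm fun i => ⌈s / l i⌉₊)).subset ?_
  intro α hα i
  have h1 : l i * α i ≤ dot l α :=
    Finset.single_le_sum (f := fun i => l i * (α i : ℝ))
      (fun i _ => mul_nonneg (hl i).le (Nat.cast_nonneg _)) (Finset.mem_univ i)
  have h2 : (α i : ℝ) ≤ s / l i := by
    rw [le_div_iff₀ (hl i), mul_comm]
    exact h1.trans hα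
  have h3 : (α i : ℝ) ≤ ⌈s / l i⌉₊ := h2.trans (Nat.le_ceil _)
  exact_mod_cast h3

/-- Weights are real numbers, but only finitely many exponents lie below a given weight. Their
number strictly drops when the weight does. -/
theorem wellFounded_dot (hl : ∀ i, 0 < l i) :
    WellFounded (fun α β : Fin n →₀ ℕ => dot l α < dot l β) := by
  refine Subrelation.wf ?_
    (measure fun α : Fin n →₀ ℕ => {β : Fin n →₀ ℕ | dot l β ≤ dot l α}.ncard).wf
  intro α β h
  refine Set.ncard_lt_ncard ?_ (dot_le_iff_finite hl _)
  refine (Set.ssubset_iff_of_subset fun x (hx : _ ≤ _) => le_trans hx h.le).2 ⟨β, le_refl (dot l β), ?_⟩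
  exact not_le.2 h

/-- By well-foundedness there is a least weight above that of `γ`. The uniform gap is what makes the
tail of a monic series small for a large scaling parameter in `exists_tail_bound`. -/
theorem exists_dot_gap (hl : ∀ i, 0 < l i) (γ : Fin n →₀ ℕ) :
    ∃ δ > 0, ∀ b : Fin n →₀ ℕ, dot l γ < dot l b → dot l γ + δ ≤ dot l b := by
  by_cases h : ∃ b, dot l γ < dot l b
  · obtain ⟨b, hb⟩ := h
    let b₀ := (wellFounded_dot hl).min {b | dot l γ < dot l b} ⟨b, hb⟩
    have hb₀ : dot l γ < dot l b₀ := (wellFounded_dot hl).min_mem {b | dot l γ < dot l b} ⟨b, hb⟩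
    refine ⟨dot l b₀ - dot l γ, sub_pos.2 hb₀, fun c hc => ?_⟩
    have := (wellFounded_dot hl).not_lt_min {b | dot l γ < dot l b} hc
    have : dot l b₀ ≤ dot l c := not_lt.1 this
    linarith
  · push Not at h
    -- No exponent is heavier than `γ`, which happens only without variables; any positive gap
    -- serves.
    exact ⟨1, one_pos, fun b hb => absurd hb (not_lt.2 (h b))⟩

/-- Together with `dot_le_degree` this makes degree and weight comparable, so that convergence can
be tested by bounds `M exp(s (l · α))`. -/
theorem exists_degree_le_dot (hl : ∀ i, 0 < l i) :
    ∃ σ ≥ 0, ∀ α : Fin n →₀ ℕ, (α.degree : ℝ) ≤ σ * dot l α := by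
  refine ⟨∑ i, (l i)⁻¹, Finset.sum_nonneg fun i _ => (inv_pos.2 (hl i)).le, fun α => ?_⟩
  rw [Finsupp.degree_eq_sum, dot, Finset.mul_sum]
  push_cast
  refine Finset.sum_le_sum fun i _ => ?_
  rw [← mul_assoc]
  refine le_mul_of_one_le_left (Nat.cast_nonneg _) ?_
  have h : (l i)⁻¹ ≤ ∑ i, (l i)⁻¹ :=
    Finset.single_le_sum (f := fun i => (l i)⁻¹) (fun i _ => (inv_pos.2 (hl i)).le)
      (Finset.mem_univ i)
  calc (1 : ℝ) = (l i)⁻¹ * l i := (inv_mul_cancel₀ (hl i).ne').symm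
    _ ≤ _ := by
      have := (hl i).le
      gcongr

theorem dot_le_degree (hl : ∀ i, 0 < l i) :
    ∃ τ ≥ 0, ∀ α : Fin n →₀ ℕ, dot l α ≤ τ * α.degree := by
  refine ⟨∑ i, l i, Finset.sum_nonneg fun i _ => (hl i).le, fun α => ?_⟩
  rw [Finsupp.degree_eq_sum, dot]
  push_cast
  rw [Finset.mul_sum]
  refine Finset.sum_le_sum fun i _ => ?_
  gcongr
  exact Finset.single_le_sum (f := l) (fun i _ => (hl i).le) (Finset.mem_univ i)

/-- Enlarging `S` to a box turns the sum into a product of `n` partial geometric series, each at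
most `2`. -/
theorem sum_half_pow_degree_le (S : Finset (Fin n →₀ ℕ)) :
    ∑ b ∈ S, (1 / 2 : ℝ) ^ b.degree ≤ 2 ^ n := by
  classical
  let N := S.sup Finsupp.degree + 1
  have hinj : Set.InjOn (fun b : Fin n →₀ ℕ => (b : Fin n → ℕ)) S :=
    fun _ _ _ _ h => DFunLike.coe_injective h
  calc ∑ b ∈ S, (1 / 2 : ℝ) ^ b.degree
      = ∑ b ∈ S, ∏ i, (1 / 2 : ℝ) ^ b i := by
        refine Finset.sum_congr rfl fun b _ => ?_
        rw [Finset.prod_pow_eq_pow_sum, Finsupp.degree_eq_sum]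
    _ = ∑ p ∈ S.image (fun b : Fin n →₀ ℕ => (b : Fin n → ℕ)), ∏ i, (1 / 2 : ℝ) ^ p i :=
        (Finset.sum_image (f := fun p : Fin n → ℕ => ∏ i, (1 / 2 : ℝ) ^ p i) hinj).symm
    _ ≤ ∑ p ∈ Fintype.piFinset fun _ : Fin n => Finset.range N, ∏ i, (1 / 2 : ℝ) ^ p i := by
        refine Finset.sum_le_sum_of_subset_of_nonneg (fun p hp => ?_) fun _ _ _ => by positivity
        obtain ⟨b, hb, rfl⟩ := Finset.mem_image.1 hp
        rw [Fintype.mem_piFinset]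
        intro i
        rw [Finset.mem_range, Nat.lt_succ_iff]
        exact (Finsupp.le_degree i b).trans (Finset.le_sup hb)
    _ = ∏ _i : Fin n, ∑ j ∈ Finset.range N, (1 / 2 : ℝ) ^ j :=
        (Finset.prod_univ_sum _ _).symm
    _ ≤ ∏ _i : Fin n, 2 := by
        refine Finset.prod_le_prod (fun _ _ => by positivity) fun _ _ => ?_
        exact sum_geometric_two_le N
    _ = 2 ^ n := by simp

end Weight

/-! ### Division of power series -/

section Division

variable {k : Type*} [Field k] {n : ℕ}

open Classical in
/-- The series `∑ h_α x^(α-γ)`, where `α` runs over the multiples of `γ` in `S`. -/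
def shiftPart (S : Set (Fin n →₀ ℕ)) (γ : Fin n →₀ ℕ) (h : MvPowerSeries (Fin n) k) :
    MvPowerSeries (Fin n) k :=
  fun α => if α + γ ∈ S then MvPowerSeries.coeff (α + γ) h else 0

open Classical in
theorem coeff_shiftPart (S : Set (Fin n →₀ ℕ)) (γ α : Fin n →₀ ℕ) (h : MvPowerSeries (Fin n) k) :
    MvPowerSeries.coeff α (shiftPart S γ h) =
      if α + γ ∈ S then MvPowerSeries.coeff (α + γ) h else 0 := rfl

open Classical in
theorem coeff_shiftPart_mul_monomial (S : Set (Fin n →₀ ℕ)) (γ α : Fin n →₀ ℕ)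
    (h : MvPowerSeries (Fin n) k) :
    MvPowerSeries.coeff α (shiftPart S γ h * MvPowerSeries.monomial γ 1) =
      if γ ≤ α ∧ α ∈ S then MvPowerSeries.coeff α h else 0 := by
  rw [MvPowerSeries.coeff_mul_monomial, mul_one]
  by_cases h1 : γ ≤ α
  · simp [h1, coeff_shiftPart, tsub_add_cancel_of_le h1]
  · simp [h1]

/-- A contraction of `k[[x]]` for a well-founded relation on the exponents has a fixed point. -/
theorem exists_fixed_point {r : (Fin n →₀ ℕ) → (Fin n →₀ ℕ) → Prop} (hr : WellFounded r)
    (T : MvPowerSeries (Fin n) k → MvPowerSeries (Fin n) k)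
    (hT : ∀ α g h, (∀ β, r β α → MvPowerSeries.coeff β g = MvPowerSeries.coeff β h) →
      MvPowerSeries.coeff α (T g) = MvPowerSeries.coeff α (T h)) :
    ∃ h, T h = h := by
  classical
  -- The coefficients not yet known are filled in with `0`; by `hT` they do not influence the
  -- coefficient at `α`.
  let F : ∀ α, (∀ β, r β α → k) → k := fun α ih =>
    MvPowerSeries.coeff α (T fun β => if hβ : r β α then ih β hβ else 0)
  let h : MvPowerSeries (Fin n) k := hr.fix F
  refine ⟨h, MvPowerSeries.ext fun α => ?_⟩
  have h1 : MvPowerSeries.coeff α h = F α fun β _ => h β := hr.fix_eq F α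
  rw [h1]
  refine hT α _ _ fun β hβ => ?_
  change h β = if hβ : r β α then h β else 0
  rw [dif_pos hβ]

variable {l : Fin n → ℝ}

/-- The exponent `γ` is the initial exponent of `f`, with coefficient `1`, for the weight `l`. -/
def IsMonicAt (l : Fin n → ℝ) (γ : Fin n →₀ ℕ) (f : MvPowerSeries (Fin n) k) : Prop :=
  ∀ b, MvPowerSeries.coeff b (f - MvPowerSeries.monomial γ 1) ≠ 0 → dot l γ < dot l b

theorem exists_isMonicAt (hl : ∀ i, 0 < l i) (hinj : Function.Injective (dot l))
    {f : MvPowerSeries (Fin n) k} (hf : f ≠ 0) :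
    ∃ γ, MvPowerSeries.coeff γ f ≠ 0 ∧
      IsMonicAt l γ (MvPowerSeries.C (MvPowerSeries.coeff γ f)⁻¹ * f) := by
  classical
  have hne : {b | MvPowerSeries.coeff b f ≠ 0}.Nonempty := by
    by_contra h
    refine hf (MvPowerSeries.ext fun b => ?_)
    by_contra hb
    exact h ⟨b, by simpa using hb⟩
  refine ⟨(wellFounded_dot hl).min _ hne, (wellFounded_dot hl).min_mem _ hne, ?_⟩
  set γ := (wellFounded_dot hl).min _ hne
  have hγ0 : MvPowerSeries.coeff γ f ≠ 0 := (wellFounded_dot hl).min_mem _ hne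
  intro b hb
  rw [map_sub, MvPowerSeries.coeff_C_mul, MvPowerSeries.coeff_monomial] at hb
  split_ifs at hb with h
  · rw [h, inv_mul_cancel₀ hγ0, sub_self] at hb
    exact absurd rfl hb
  · rw [sub_zero] at hb
    have h1 := (wellFounded_dot hl).not_lt_min {b | MvPowerSeries.coeff b f ≠ 0}
      (right_ne_zero_of_mul hb)
    exact lt_of_le_of_ne (not_lt.1 h1) fun h2 => h (hinj h2).symm

/-- The solution `h` is the remainder plus the sum of the quotients times the leading monomials. The
right-hand side is a contraction: the coefficient at `α = a + b` uses `h` only at `a + γ i` with `b`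
an exponent of `t i`, and `b` is heavier than `γ i`. -/
theorem exists_division_fixed_point (hl : ∀ i, 0 < l i) {ι : Type*} [Fintype ι]
    (γ : ι → Fin n →₀ ℕ) (t : ι → MvPowerSeries (Fin n) k)
    (ht : ∀ i b, MvPowerSeries.coeff b (t i) ≠ 0 → dot l (γ i) < dot l b)
    (S : ι → Set (Fin n →₀ ℕ)) (f : MvPowerSeries (Fin n) k) :
    ∃ h, f - ∑ i, shiftPart (S i) (γ i) h * t i = h := by
  classical
  refine exists_fixed_point (wellFounded_dot hl)
    (fun h => f - ∑ i, shiftPart (S i) (γ i) h * t i) fun α g h hgh => ?_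
  simp only [map_sub, map_sum]
  congr 1
  refine Finset.sum_congr rfl fun i _ => ?_
  rw [MvPowerSeries.coeff_mul, MvPowerSeries.coeff_mul]
  refine Finset.sum_congr rfl fun x hx => ?_
  rw [Finset.HasAntidiagonal.mem_antidiagonal] at hx
  by_cases h0 : MvPowerSeries.coeff x.2 (t i) = 0
  · rw [h0, mul_zero, mul_zero]
  · have h1 := ht i _ h0
    rw [coeff_shiftPart, coeff_shiftPart, hgh]
    rw [← hx, dot_add, dot_add]
    linarith

/-- The remainder of the division of `f` by the series `x^γᵢ + tᵢ` involves no multiple of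
the `x^γᵢ`. -/
theorem division_of_fixed_point {ι : Type*} [Fintype ι]
    (γ : ι → Fin n →₀ ℕ) (g : ι → MvPowerSeries (Fin n) k)
    (S : ι → Set (Fin n →₀ ℕ)) (hS : ∀ α i, γ i ≤ α → ∃! j, γ j ≤ α ∧ α ∈ S j)
    {f h : MvPowerSeries (Fin n) k}
    (hh : f - ∑ i, shiftPart (S i) (γ i) h * (g i - MvPowerSeries.monomial (γ i) 1) = h)
    (α : Fin n →₀ ℕ) (i : ι) (hi : γ i ≤ α) :
    MvPowerSeries.coeff α (f - ∑ i, shiftPart (S i) (γ i) h * g i) = 0 := by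
  classical
  -- Writing `g i` as its leading monomial plus a tail, the fixed point equation absorbs the tails.
  have h1 : f - ∑ i, shiftPart (S i) (γ i) h * g i =
      h - ∑ i, shiftPart (S i) (γ i) h * MvPowerSeries.monomial (γ i) 1 := by
    simp only [mul_sub, Finset.sum_sub_distrib] at hh
    refine eq_sub_of_add_eq (Eq.trans ?_ hh)
    abel
  rw [h1, map_sub, map_sum]
  simp only [coeff_shiftPart_mul_monomial]
  -- Exactly one `j` claims the exponent `α`, so the coefficient of `h` at `α` is subtracted exactly
  -- once.
  obtain ⟨j, hj, hju⟩ := hS α i hi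
  rw [Finset.sum_eq_single j, if_pos hj, sub_self]
  · intro b _ hb
    exact if_neg fun h => hb (hju b h)
  · simp

end Division

/-! ### Division of convergent power series -/

namespace CoeffRing

variable {n : ℕ} {l : Fin n → ℝ}

/-- The point is that `M` is independent of `s`, so that `s` can later be enlarged to suit several
series at once. -/
theorem exists_exp_bound (hl : ∀ i, 0 < l i) {f : MvPowerSeries (Fin n) ℂ}
    (hf : f ∈ (analytic n).toSubalgebra) :
    ∃ M s₀ : ℝ, 0 ≤ M ∧ ∀ s ≥ s₀, ∀ α, ‖MvPowerSeries.coeff α f‖ ≤ M * Real.exp (s * dot l α) := by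
  obtain ⟨M, R, hR, hf⟩ := hf
  have hM : 0 ≤ M := by simpa using (norm_nonneg _).trans (hf 0)
  obtain ⟨σ, hσ, hd⟩ := exists_degree_le_dot hl
  refine ⟨M, R * σ, hM, fun s hs α => (hf α).trans ?_⟩
  gcongr
  have h1 : R ≤ Real.exp R := by linarith [Real.add_one_le_exp R]
  calc R ^ α.degree ≤ Real.exp R ^ α.degree := by gcongr
    _ = Real.exp (α.degree * R) := (Real.exp_nat_mul _ _).symm
    _ ≤ _ := by
      rw [Real.exp_le_exp]
      have h2 := dot_nonneg hl α
      calc α.degree * R ≤ (σ * dot l α) * R := by gcongr; exact hd α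
        _ = R * σ * dot l α := by ring
        _ ≤ _ := by gcongr

theorem mem_analytic_of_exp_bound (hl : ∀ i, 0 < l i) {f : MvPowerSeries (Fin n) ℂ} {M s : ℝ}
    (hf : ∀ α, ‖MvPowerSeries.coeff α f‖ ≤ M * Real.exp (s * dot l α)) :
    f ∈ (analytic n).toSubalgebra := by
  have hM : 0 ≤ M := by simpa [dot_zero] using (norm_nonneg _).trans (hf 0)
  obtain ⟨τ, hτ, hd⟩ := dot_le_degree hl
  refine ⟨M, Real.exp (|s| * τ), (Real.exp_pos _).le, fun α => (hf α).trans ?_⟩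
  gcongr
  rw [← Real.exp_nat_mul, Real.exp_le_exp]
  have h2 := dot_nonneg hl α
  calc s * dot l α ≤ |s| * (τ * α.degree) :=
        mul_le_mul (le_abs_self s) (hd α) h2 (abs_nonneg s)
    _ = _ := by ring

theorem shiftPart_mem_analytic (S : Set (Fin n →₀ ℕ)) (γ : Fin n →₀ ℕ)
    {f : MvPowerSeries (Fin n) ℂ} (hf : f ∈ (analytic n).toSubalgebra) :
    shiftPart S γ f ∈ (analytic n).toSubalgebra := by
  obtain ⟨M, R, hR, hf⟩ := hf
  have hM : 0 ≤ M := by simpa using (norm_nonneg _).trans (hf 0)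
  refine ⟨M * R ^ γ.degree, R, hR, fun α => ?_⟩
  rw [coeff_shiftPart]
  split_ifs
  · refine (hf _).trans (le_of_eq ?_)
    rw [map_add, pow_add]
    ring
  · rw [norm_zero]
    positivity

/-- The weighted norm of a convergent series all of whose exponents have weight larger than `γ` is
small compared to that of `x^γ`. -/
theorem exists_tail_bound (hl : ∀ i, 0 < l i) {t : MvPowerSeries (Fin n) ℂ}
    (ht : t ∈ (analytic n).toSubalgebra) (γ : Fin n →₀ ℕ)
    (htγ : ∀ b, MvPowerSeries.coeff b t ≠ 0 → dot l γ < dot l b) {ε : ℝ} (hε : 0 < ε) :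
    ∃ s₀ : ℝ, ∀ s ≥ s₀, ∀ S : Finset (Fin n →₀ ℕ),
      ∑ b ∈ S, ‖MvPowerSeries.coeff b t‖ * Real.exp (s * (dot l γ - dot l b)) ≤ ε := by
  obtain ⟨M, s₁, hM, hb⟩ := exists_exp_bound hl ht
  obtain ⟨σ, hσ, hd⟩ := exists_degree_le_dot hl
  obtain ⟨δ, hδ, hgap⟩ := exists_dot_gap hl γ
  -- The parameter `s` is spent in three parts: `s₁` bounds the coefficients of `t`, `σ` pays for a
  -- factor `exp(-|b|)` that makes the sum over `b` converge, and the excess `s - s₂` is multiplied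
  -- by the gap `δ`.
  set s₂ := s₁ + σ with hs₂
  set K := M * Real.exp (s₂ * dot l γ) * 2 ^ n with hK
  have hK0 : 0 ≤ K := by positivity
  -- From here on `K ≤ ε (s - s₂) δ`, and `x ≤ exp x` then gives `K exp(-(s - s₂) δ) ≤ ε`.
  refine ⟨s₂ + K / (ε * δ), fun s hs S => ?_⟩
  have hu : K / (ε * δ) ≤ s - s₂ := by linarith
  have hu0 : 0 ≤ s - s₂ := le_trans (by positivity) hu
  have hterm : ∀ b ∈ S, ‖MvPowerSeries.coeff b t‖ * Real.exp (s * (dot l γ - dot l b)) ≤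
      M * Real.exp (s₂ * dot l γ) * Real.exp (-((s - s₂) * δ)) * (1 / 2) ^ b.degree := by
    intro b _
    by_cases h0 : MvPowerSeries.coeff b t = 0
    · rw [h0, norm_zero, zero_mul]
      positivity
    · have h1 := hgap b (htγ b h0)
      have h2 : Real.exp (-(b.degree : ℝ)) ≤ (1 / 2) ^ b.degree := by
        rw [show -(b.degree : ℝ) = b.degree * (-1) by ring, Real.exp_nat_mul]
        gcongr
        rw [Real.exp_neg, ← one_div]
        exact one_div_le_one_div_of_le two_pos (by linarith [Real.add_one_le_exp (1 : ℝ)])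
      calc ‖MvPowerSeries.coeff b t‖ * Real.exp (s * (dot l γ - dot l b))
          ≤ M * Real.exp (s₁ * dot l b) * Real.exp (s * (dot l γ - dot l b)) := by
            gcongr
            exact hb s₁ le_rfl b
        _ = M * Real.exp (s₁ * dot l b + s * (dot l γ - dot l b)) := by
            rw [mul_assoc, ← Real.exp_add]
        _ ≤ M * Real.exp (s₂ * dot l γ + -((s - s₂) * δ) + -(b.degree : ℝ)) := by
            refine mul_le_mul_of_nonneg_left (Real.exp_le_exp.2 ?_) hM
            have h3 := hd b
            have h4 : (s - s₂) * (dot l γ - dot l b) ≤ (s - s₂) * (-δ) := by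
              gcongr
              linarith
            rw [hs₂] at h4 ⊢
            linarith
        _ = M * Real.exp (s₂ * dot l γ) * Real.exp (-((s - s₂) * δ)) *
              Real.exp (-(b.degree : ℝ)) := by
            rw [Real.exp_add, Real.exp_add]
            ring
        _ ≤ _ := by gcongr
  refine (Finset.sum_le_sum hterm).trans ?_
  rw [← Finset.mul_sum]
  calc M * Real.exp (s₂ * dot l γ) * Real.exp (-((s - s₂) * δ)) * ∑ b ∈ S, (1 / 2) ^ b.degree
      ≤ M * Real.exp (s₂ * dot l γ) * Real.exp (-((s - s₂) * δ)) * 2 ^ n := by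
        gcongr
        exact sum_half_pow_degree_le S
    _ = K * Real.exp (-((s - s₂) * δ)) := by rw [hK]; ring
    _ ≤ ε := by
        rw [Real.exp_neg, ← div_eq_mul_inv, div_le_iff₀ (Real.exp_pos _)]
        have h5 := Real.add_one_le_exp ((s - s₂) * δ)
        rw [div_le_iff₀ (by positivity)] at hu
        calc K ≤ (s - s₂) * (ε * δ) := hu
          _ = ε * ((s - s₂) * δ) := by ring
          _ ≤ _ := by
            gcongr
            linarith

/-- Induction on the weight proves the bound `2M exp(s (l · α))`: for large `s` the series `f`
contributes at most half of it, and the tails, being small in the weighted norm, at most the other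
half. -/
theorem mem_analytic_of_fixed_point (hl : ∀ i, 0 < l i) {ι : Type*} [Fintype ι]
    (γ : ι → Fin n →₀ ℕ) (t : ι → MvPowerSeries (Fin n) ℂ)
    (htC : ∀ i, t i ∈ (analytic n).toSubalgebra)
    (ht : ∀ i b, MvPowerSeries.coeff b (t i) ≠ 0 → dot l (γ i) < dot l b)
    (S : ι → Set (Fin n →₀ ℕ)) {f h : MvPowerSeries (Fin n) ℂ}
    (hf : f ∈ (analytic n).toSubalgebra)
    (hh : f - ∑ i, shiftPart (S i) (γ i) h * t i = h) : h ∈ (analytic n).toSubalgebra := by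
  classical
  obtain ⟨M, s₀, hM, hb⟩ := exists_exp_bound hl hf
  -- With this `ε` all the tails together contribute at most half; the `+ 1` guards against an empty
  -- index type.
  have hε : (0 : ℝ) < 1 / (2 * (Fintype.card ι + 1)) := by positivity
  choose s₁ hs₁ using fun i => exists_tail_bound hl (htC i) (γ i) (ht i) hε
  set s := max s₀ (∑ i, |s₁ i|)
  have hss : ∀ i, s ≥ s₁ i := fun i =>
    (le_abs_self _).trans ((Finset.single_le_sum (f := fun i => |s₁ i|)
      (fun i _ => abs_nonneg _) (Finset.mem_univ i)).trans (le_max_right _ _))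
  refine mem_analytic_of_exp_bound hl (M := 2 * M) (s := s) fun α => ?_
  induction α using (wellFounded_dot hl).induction with
  | _ α ih =>
  have hterm : ∀ i, ‖MvPowerSeries.coeff α (shiftPart (S i) (γ i) h * t i)‖ ≤
      2 * M * Real.exp (s * dot l α) * (1 / (2 * (Fintype.card ι + 1))) := by
    intro i
    rw [MvPowerSeries.coeff_mul]
    have h1 : ∀ x ∈ Finset.HasAntidiagonal.antidiagonal α,
        ‖MvPowerSeries.coeff x.1 (shiftPart (S i) (γ i) h) * MvPowerSeries.coeff x.2 (t i)‖ ≤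
        2 * M * Real.exp (s * dot l α) *
          (‖MvPowerSeries.coeff x.2 (t i)‖ * Real.exp (s * (dot l (γ i) - dot l x.2))) := by
      intro x hx
      rw [Finset.HasAntidiagonal.mem_antidiagonal] at hx
      by_cases h0 : MvPowerSeries.coeff x.2 (t i) = 0
      · simp [h0]
      · have h1 := ht i _ h0
        have h2 : ‖MvPowerSeries.coeff x.1 (shiftPart (S i) (γ i) h)‖ ≤
            2 * M * Real.exp (s * dot l (x.1 + γ i)) := by
          rw [coeff_shiftPart]
          split_ifs
          · refine ih _ ?_
            rw [← hx, dot_add, dot_add]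
            linarith
          · rw [norm_zero]
            positivity
        rw [norm_mul]
        calc ‖MvPowerSeries.coeff x.1 (shiftPart (S i) (γ i) h)‖ * ‖MvPowerSeries.coeff x.2 (t i)‖
            ≤ 2 * M * Real.exp (s * dot l (x.1 + γ i)) * ‖MvPowerSeries.coeff x.2 (t i)‖ := by
              gcongr
          _ = 2 * M * Real.exp (s * dot l α + s * (dot l (γ i) - dot l x.2)) *
                ‖MvPowerSeries.coeff x.2 (t i)‖ := by
              rw [← hx, dot_add, dot_add]
              ring_nf
          _ = _ := by
              rw [Real.exp_add]
              ring
    refine (norm_sum_le _ _).trans ((Finset.sum_le_sum h1).trans ?_)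
    rw [← Finset.mul_sum]
    gcongr
    have hinj : Set.InjOn Prod.snd
        ((Finset.HasAntidiagonal.antidiagonal α : Finset _) :
          Set ((Fin n →₀ ℕ) × (Fin n →₀ ℕ))) := by
      intro x hx y hy h
      rw [Finset.mem_coe, Finset.HasAntidiagonal.mem_antidiagonal] at hx hy
      rw [← hy, h] at hx
      exact Prod.ext (add_right_cancel hx) h
    rw [← Finset.sum_image (f := fun b => ‖MvPowerSeries.coeff b (t i)‖ *
      Real.exp (s * (dot l (γ i) - dot l b))) hinj]
    exact hs₁ i s (hss i) _
  rw [← hh, map_sub, map_sum]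
  refine (norm_sub_le _ _).trans ?_
  have h3 := hb s (le_max_left _ _) α
  have h4 : ‖∑ i, MvPowerSeries.coeff α (shiftPart (S i) (γ i) h * t i)‖ ≤
      M * Real.exp (s * dot l α) := by
    refine (norm_sum_le _ _).trans ((Finset.sum_le_card_nsmul _ _ _ fun i _ => hterm i).trans ?_)
    rw [nsmul_eq_mul, Finset.card_univ]
    have h5 : (0 : ℝ) ≤ Fintype.card ι := Nat.cast_nonneg _
    calc (Fintype.card ι : ℝ) * (2 * M * Real.exp (s * dot l α) * (1 / (2 * (Fintype.card ι + 1))))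
        = M * Real.exp (s * dot l α) * (Fintype.card ι / (Fintype.card ι + 1)) := by
          field_simp
      _ ≤ M * Real.exp (s * dot l α) * 1 := by
          gcongr
          rw [div_le_one (by positivity)]
          linarith
      _ = _ := mul_one _
  linarith

/-- Division of a convergent power series by finitely many monic ones. -/
theorem analytic_division (hl : ∀ i, 0 < l i) {ι : Type*} [Fintype ι]
    (γ : ι → Fin n →₀ ℕ) (g : ι → MvPowerSeries (Fin n) ℂ)
    (hgC : ∀ i, g i ∈ (analytic n).toSubalgebra) (hg : ∀ i, IsMonicAt l (γ i) (g i))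
    {f : MvPowerSeries (Fin n) ℂ} (hf : f ∈ (analytic n).toSubalgebra) :
    ∃ q : ι → MvPowerSeries (Fin n) ℂ, (∀ i, q i ∈ (analytic n).toSubalgebra) ∧
      ∀ α i, γ i ≤ α → MvPowerSeries.coeff α (f - ∑ i, q i * g i) = 0 := by
  classical
  -- Each exponent is assigned to a single `γ i` below it, which makes the sets `S i` disjoint.
  let idx : (Fin n →₀ ℕ) → Option ι := fun α =>
    if h : ∃ i, γ i ≤ α then some h.choose else none
  let S : ι → Set (Fin n →₀ ℕ) := fun i => {α | idx α = some i}
  have hS : ∀ α i, γ i ≤ α → ∃! j, γ j ≤ α ∧ α ∈ S j := by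
    intro α i hi
    have h : ∃ i, γ i ≤ α := ⟨i, hi⟩
    have hidx : idx α = some h.choose := dif_pos h
    refine ⟨h.choose, ⟨h.choose_spec, hidx⟩, ?_⟩
    rintro j ⟨-, hj⟩
    have hj : idx α = some j := hj
    rw [hidx] at hj
    exact (Option.some_injective _ hj).symm
  have htC : ∀ i, g i - MvPowerSeries.monomial (γ i) 1 ∈ (analytic n).toSubalgebra := by
    intro i
    refine sub_mem (hgC i) (alg_le_analytic (poly_le_alg ⟨MvPolynomial.monomial (γ i) 1, ?_⟩))
    simp
  obtain ⟨h, hh⟩ := exists_division_fixed_point hl γ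
    (fun i => g i - MvPowerSeries.monomial (γ i) 1) hg S f
  have hC := mem_analytic_of_fixed_point hl γ _ htC hg S hf hh
  exact ⟨fun i => shiftPart (S i) (γ i) h, fun i => shiftPart_mem_analytic _ _ hC,
    fun α i hi => division_of_fixed_point γ g S hS hh α i hi⟩

/-- Divide `1` by the multiple of `f` that has constant term `1`. Its initial exponent is `0`, which
lies below every exponent, so the remainder vanishes. -/
theorem exists_mul_eq_one_of_analytic {f : MvPowerSeries (Fin n) ℂ}
    (hf : f ∈ (analytic n).toSubalgebra) (h0 : MvPowerSeries.constantCoeff f ≠ 0) :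
    ∃ g ∈ (analytic n).toSubalgebra, g * f = 1 := by
  classical
  obtain ⟨l, hl, hinj⟩ := exists_pos_injective_dot n
  set c := (MvPowerSeries.constantCoeff f)⁻¹ with hc
  have hcC : MvPowerSeries.C c ∈ (analytic n).toSubalgebra :=
    (analytic n).algebraMap_mem' c
  have hmon : IsMonicAt l 0 (MvPowerSeries.C c * f) := by
    intro b hb
    rw [map_sub, MvPowerSeries.coeff_C_mul, MvPowerSeries.coeff_monomial] at hb
    split_ifs at hb with h
    · rw [h, MvPowerSeries.coeff_zero_eq_constantCoeff_apply, hc, inv_mul_cancel₀ h0,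
        sub_self] at hb
      exact absurd rfl hb
    · rw [dot_zero]
      refine lt_of_le_of_ne (dot_nonneg hl b) fun h1 => h (hinj ?_)
      rw [← h1, dot_zero]
  obtain ⟨q, hq, hr⟩ := analytic_division hl (ι := Unit) (fun _ => 0)
    (fun _ => MvPowerSeries.C c * f) (fun _ => mul_mem hcC hf) (fun _ => hmon)
    (one_mem (analytic n).toSubalgebra)
  refine ⟨q () * MvPowerSeries.C c, mul_mem (hq ()) hcC, ?_⟩
  have : (1 : MvPowerSeries (Fin n) ℂ) - ∑ i, q i * (MvPowerSeries.C c * f) = 0 :=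
    MvPowerSeries.ext fun α => hr α () bot_le
  rw [Fintype.sum_unique, sub_eq_zero] at this
  rw [mul_assoc, this]

/-- Dickson's lemma: the minimal elements form an antichain in a well-quasi-order, hence a finite
set. -/
theorem exists_finset_forall_exists_le (E : Set (Fin n →₀ ℕ)) :
    ∃ T : Finset (Fin n →₀ ℕ), (T : Set (Fin n →₀ ℕ)) ⊆ E ∧ ∀ α ∈ E, ∃ γ ∈ T, γ ≤ α := by
  have hfin : {α | Minimal (· ∈ E) α}.Finite :=
    WellQuasiOrderedLE.finite_of_isAntichain (setOfPred_minimal_antichain _)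
  refine ⟨hfin.toFinset, fun α hα => ?_, fun α hα => ?_⟩
  · rw [Finset.mem_coe, Set.Finite.mem_toFinset] at hα
    exact hα.1
  · obtain ⟨γ, hγ, hm⟩ := exists_minimal_le_of_wellFoundedLT (· ∈ E) α hα
    exact ⟨γ, hfin.mem_toFinset.2 hm, hγ⟩

/-- The standard basis argument: choose elements of `I` whose initial exponents lie below all
initial exponents of `I`. The remainder of an element of `I` after division by them is again in `I`,
and a nonzero one would have an initial exponent that the division has removed. -/
instance isNoetherianRing_analytic : IsNoetherianRing (analytic n).toSubalgebra := by
  classical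
  obtain ⟨l, hl, hinj⟩ := exists_pos_injective_dot n
  refine isNoetherianRing_iff_ideal_fg _ |>.2 fun I => ?_
  obtain ⟨T, hTE, hT⟩ := exists_finset_forall_exists_le
    {γ | ∃ f ∈ I, IsMonicAt l γ (f : MvPowerSeries (Fin n) ℂ)}
  have hTE' : ∀ γ : T, ∃ f ∈ I, IsMonicAt l γ (f : MvPowerSeries (Fin n) ℂ) := by
    intro γ
    have h := hTE (Finset.mem_coe.2 γ.2)
    rwa [Set.mem_ofPred_eq] at h
  choose g hgI hg using hTE'
  have hspan : Ideal.span (Set.range g) ≤ I := by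
    rw [Ideal.span_le]
    rintro _ ⟨γ, rfl⟩
    exact hgI γ
  refine ⟨Finset.univ.image g, ?_⟩
  rw [Finset.coe_image, Finset.coe_univ, Set.image_univ]
  refine le_antisymm hspan fun f hf => ?_
  obtain ⟨q, hq, hr⟩ := analytic_division hl (fun γ : T => (γ : Fin n →₀ ℕ)) (fun γ => (g γ).1)
    (fun γ => (g γ).2) hg f.2
  obtain ⟨r, hrdef⟩ : ∃ r, r = f - ∑ γ, (⟨q γ, hq γ⟩ : (analytic n).toSubalgebra) * g γ := ⟨_, rfl⟩
  have hsum : f - r ∈ Ideal.span (Set.range g) := by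
    rw [hrdef, sub_sub_cancel]
    exact sum_mem fun γ _ => Ideal.mul_mem_left _ _ (Ideal.subset_span ⟨γ, rfl⟩)
  have hrI : r ∈ I := by
    have h := sub_mem hf (hspan hsum)
    rwa [sub_sub_cancel] at h
  have hrval : (r : MvPowerSeries (Fin n) ℂ) = f - ∑ γ, q γ * (g γ).1 := by
    rw [hrdef, AddSubgroupClass.coe_sub, AddSubmonoidClass.coe_finsetSum]
    rfl
  by_cases hne : (r : MvPowerSeries (Fin n) ℂ) = 0
  · have h : r = 0 := Subtype.ext hne
    rwa [h, sub_zero] at hsum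
  · exfalso
    obtain ⟨α, hα, hmon⟩ := exists_isMonicAt hl hinj hne
    have hcC : MvPowerSeries.C (MvPowerSeries.coeff α (r : MvPowerSeries (Fin n) ℂ))⁻¹ ∈
        (analytic n).toSubalgebra := (analytic n).algebraMap_mem' _
    have hαE : α ∈ {γ | ∃ f ∈ I, IsMonicAt l γ (f : MvPowerSeries (Fin n) ℂ)} := by
      rw [Set.mem_ofPred_eq]
      exact ⟨_, I.mul_mem_left ⟨_, hcC⟩ hrI, hmon⟩
    obtain ⟨γ, hγ, hγα⟩ := hT α hαE
    rw [hrval] at hα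
    exact hα (hr α ⟨γ, hγ⟩ hγα)

end CoeffRing
/-! ### Flatness of extensions of coefficient rings -/

section Flat

variable {k : Type*} [Field k] {n : ℕ}

theorem span_le_span_of_le {M V : Type*} [CommRing M] [Algebra k M] [AddCommGroup V] [Module M V]
    {C C' : Subalgebra k M} (h : C ≤ C') {s t : Set V} (hst : ∀ v ∈ s, v ∈ Submodule.span C' t)
    {x : V} (hx : x ∈ Submodule.span C s) : x ∈ Submodule.span C' t := by
  induction hx using Submodule.span_induction with
  | mem x hx => exact hst x hx
  | zero => exact zero_mem _
  | add x y _ _ hx hy => exact add_mem hx hy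
  | smul c x _ hx => exact Submodule.smul_mem _ (⟨c.1, h c.2⟩ : C') hx

/-- The equational criterion of flatness for `C ⊆ C'`: the solutions in `C'` of a homogeneous
system of linear equations over `C` are linear combinations of solutions in `C`. -/
def LinFlat (C C' : Subalgebra k (MvPowerSeries (Fin n) k)) : Prop :=
  ∀ (p q : Type) [Fintype p] [Fintype q] (A : q → p → MvPowerSeries (Fin n) k),
    (∀ i j, A i j ∈ C) → ∀ c : p → MvPowerSeries (Fin n) k, (∀ j, c j ∈ C') →
    (∀ i, ∑ j, A i j * c j = 0) →
    c ∈ Submodule.span C' {b : p → MvPowerSeries (Fin n) k |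
      (∀ j, b j ∈ C) ∧ ∀ i, ∑ j, A i j * b j = 0}

/-- `C` contains with `f` all the series `∑ f_α x^(α-γ)`, `α` running over the multiples of `γ` in
some set. -/
def ShiftClosed (C : Subalgebra k (MvPowerSeries (Fin n) k)) : Prop :=
  ∀ (S : Set (Fin n →₀ ℕ)) (γ : Fin n →₀ ℕ), ∀ f ∈ C, shiftPart S γ f ∈ C

/-- An element of `C` all of whose monomials lie in a monomial ideal is a combination of the
generators with coefficients in `C`. -/
def MonomialClosed (C : Subalgebra k (MvPowerSeries (Fin n) k)) : Prop :=
  ∀ f ∈ C, ∀ T : Finset (Fin n →₀ ℕ),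
    (∀ b, MvPowerSeries.coeff b f ≠ 0 → ∃ γ ∈ T, γ ≤ b) →
    f ∈ Submodule.span C ((fun γ => MvPowerSeries.monomial γ (1 : k)) '' (T : Set (Fin n →₀ ℕ)))

/-- Assign every exponent of `f` to one generator below it; the terms assigned to `γ` add up to a
shifted part of `f` times `x^γ`. -/
theorem ShiftClosed.monomialClosed {C : Subalgebra k (MvPowerSeries (Fin n) k)}
    (hC : ShiftClosed C) : MonomialClosed C := by
  classical
  intro f hf T hT
  let idx : (Fin n →₀ ℕ) → Option (Fin n →₀ ℕ) := fun α =>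
    if h : ∃ γ ∈ T, γ ≤ α then some h.choose else none
  have key : f = ∑ γ ∈ T, shiftPart {α | idx α = some γ} γ f * MvPowerSeries.monomial γ 1 := by
    ext b
    rw [map_sum]
    simp only [coeff_shiftPart_mul_monomial]
    by_cases hb : MvPowerSeries.coeff b f = 0
    · simp [hb]
    · have h := hT b hb
      have hidx : idx b = some h.choose := dif_pos h
      rw [Finset.sum_eq_single_of_mem h.choose h.choose_spec.1]
      · exact (if_pos ⟨h.choose_spec.2, hidx⟩).symm
      · intro γ _ hγ
        refine if_neg fun h2 => hγ ?_
        have h3 : idx b = some γ := h2.2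
        rw [hidx] at h3
        exact (Option.some_injective _ h3).symm
  rw [key]
  exact sum_mem fun γ hγ => Submodule.smul_mem _ (⟨_, hC _ γ f hf⟩ : C)
    (Submodule.subset_span ⟨γ, hγ, rfl⟩)

theorem monomial_mem_poly (γ : Fin n →₀ ℕ) (a : k) :
    MvPowerSeries.monomial γ a ∈ (CoeffRing.poly k n).toSubalgebra :=
  ⟨MvPolynomial.monomial γ a, by simp⟩

/-- The ideal of the series in `C` without constant term. -/
def maxIdeal (C : Subalgebra k (MvPowerSeries (Fin n) k)) : Ideal C :=
  RingHom.ker ((MvPowerSeries.constantCoeff (σ := Fin n) (R := k)).comp C.val.toRingHom)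

theorem mem_maxIdeal {C : Subalgebra k (MvPowerSeries (Fin n) k)} {f : C} :
    f ∈ maxIdeal C ↔ MvPowerSeries.constantCoeff (f : MvPowerSeries (Fin n) k) = 0 := Iff.rfl

theorem monomial_mem_maxIdeal_pow {C : Subalgebra k (MvPowerSeries (Fin n) k)}
    (hP : (CoeffRing.poly k n).toSubalgebra ≤ C) (γ : Fin n →₀ ℕ) :
    (⟨MvPowerSeries.monomial γ 1, hP (monomial_mem_poly γ 1)⟩ : C) ∈ maxIdeal C ^ γ.degree := by
  induction γ using DiffOp.induction_add_single with
  | zero => simp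
  | add γ i ih =>
    rw [map_add, Finsupp.degree_single, pow_succ]
    have h : (⟨MvPowerSeries.monomial (γ + Finsupp.single i 1) 1,
        hP (monomial_mem_poly _ 1)⟩ : C) =
        ⟨MvPowerSeries.monomial γ 1, hP (monomial_mem_poly γ 1)⟩ *
        ⟨MvPowerSeries.monomial (Finsupp.single i 1) 1, hP (monomial_mem_poly _ 1)⟩ := by
      refine Subtype.ext ?_
      change _ = MvPowerSeries.monomial γ (1 : k) * MvPowerSeries.monomial (Finsupp.single i 1) 1
      rw [MvPowerSeries.monomial_mul_monomial, one_mul]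
    rw [h]
    refine Ideal.mul_mem_mul ih ?_
    rw [mem_maxIdeal]
    exact MvPowerSeries.constantCoeff_X i

/-- The exponents of degree at least `N` have finitely many minimal ones, whose monomials lie in the
`N`-th power of the ideal. Thus vanishing to order `N` in `k[[x]]` is detected inside `C`. -/
theorem mem_maxIdeal_pow {C : Subalgebra k (MvPowerSeries (Fin n) k)}
    (hP : (CoeffRing.poly k n).toSubalgebra ≤ C) (hC : MonomialClosed C) {N : ℕ} (f : C)
    (hf : ∀ b : Fin n →₀ ℕ, b.degree < N → MvPowerSeries.coeff b f.1 = 0) :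
    f ∈ maxIdeal C ^ N := by
  obtain ⟨T, hT, hTE⟩ := CoeffRing.exists_finset_forall_exists_le {γ : Fin n →₀ ℕ | N ≤ γ.degree}
  have hmem := hC f.1 f.2 T fun b hb => hTE b (not_lt.1 fun h => hb (hf b h))
  suffices h : ∀ g ∈ Submodule.span C
      ((fun γ => MvPowerSeries.monomial γ (1 : k)) '' (T : Set (Fin n →₀ ℕ))),
      ∃ h : g ∈ C, (⟨g, h⟩ : C) ∈ maxIdeal C ^ N from (h _ hmem).2
  intro g hg
  induction hg using Submodule.span_induction with
  | mem x hx =>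
    obtain ⟨γ, hγ, rfl⟩ := hx
    exact ⟨_, Ideal.pow_le_pow_right (hT hγ) (monomial_mem_maxIdeal_pow hP γ)⟩
  | zero => exact ⟨zero_mem _, zero_mem _⟩
  | add x y _ _ hx hy =>
    obtain ⟨hx, hx'⟩ := hx
    obtain ⟨hy, hy'⟩ := hy
    exact ⟨add_mem hx hy, add_mem hx' hy'⟩
  | smul c x _ hx =>
    obtain ⟨hx, hx'⟩ := hx
    exact ⟨mul_mem c.2 hx, Ideal.mul_mem_left _ c hx'⟩

theorem exists_poly_trunc (f : MvPowerSeries (Fin n) k) (N : ℕ) :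
    ∃ g ∈ (CoeffRing.poly k n).toSubalgebra,
      ∀ b : Fin n →₀ ℕ, b.degree < N → MvPowerSeries.coeff b (f - g) = 0 := by
  classical
  have hfin : {b : Fin n →₀ ℕ | dot (fun _ => 1) b ≤ N}.Finite :=
    dot_le_iff_finite (fun _ => one_pos) N
  refine ⟨∑ b ∈ hfin.toFinset, MvPowerSeries.monomial b (MvPowerSeries.coeff b f),
    sum_mem fun b _ => monomial_mem_poly _ _, fun b hb => ?_⟩
  rw [map_sub, map_sum]
  simp only [MvPowerSeries.coeff_monomial]
  rw [Finset.sum_ite_eq, if_pos, sub_self]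
  rw [Set.Finite.mem_toFinset]
  have h : dot (fun _ => 1) b = (b.degree : ℝ) := by
    simp [dot, Finsupp.degree_eq_sum]
  change dot (fun _ => 1) b ≤ N
  rw [h]
  exact_mod_cast hb.le

theorem coeff_mul_eq_zero_of_degree_lt {N : ℕ} (a : MvPowerSeries (Fin n) k)
    {t : MvPowerSeries (Fin n) k}
    (ht : ∀ b : Fin n →₀ ℕ, b.degree < N → MvPowerSeries.coeff b t = 0) (b : Fin n →₀ ℕ)
    (hb : b.degree < N) : MvPowerSeries.coeff b (a * t) = 0 := by
  classical
  rw [MvPowerSeries.coeff_mul]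
  refine Finset.sum_eq_zero fun x hx => ?_
  rw [Finset.HasAntidiagonal.mem_antidiagonal] at hx
  rw [ht, mul_zero]
  rw [← hx, map_add] at hb
  omega

theorem mem_smul_top_pi {R : Type*} [CommRing R] (I : Ideal R) {p : Type*} [Fintype p] (e : p → R) :
    e ∈ (I • ⊤ : Submodule R (p → R)) ↔ ∀ j, e j ∈ I := by
  classical
  refine ⟨fun h j => ?_, fun h => ?_⟩
  · have := Submodule.mem_map_of_mem (f := LinearMap.proj (R := R) (φ := fun _ : p => R) j) h
    rw [Submodule.map_smul''] at this
    refine (Submodule.smul_le (P := I)).2 (fun a ha b _ => ?_) this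
    exact I.mul_mem_right b ha
  · rw [← Finset.univ_sum_single e]
    refine sum_mem fun j _ => ?_
    have : Pi.single j (e j) = e j • (Pi.single j 1 : p → R) := by
      rw [← Pi.single_smul, smul_eq_mul, mul_one]
    rw [this]
    exact Submodule.smul_mem_smul (h j) trivial

/-- An extension `C ⊆ C'` of noetherian rings of power series, with `C'` local, is flat: by the
lemma of Artin and Rees the solutions in `C` are dense, and by Krull's intersection theorem their
span is closed. -/
theorem linFlat_of_isNoetherianRing {C C' : Subalgebra k (MvPowerSeries (Fin n) k)} (hle : C ≤ C')
    (hP : (CoeffRing.poly k n).toSubalgebra ≤ C) [IsNoetherianRing C] [IsNoetherianRing C']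
    (hC : MonomialClosed C) (hC' : MonomialClosed C')
    (hunit : ∀ f ∈ C', MvPowerSeries.constantCoeff f ≠ 0 → ∃ g ∈ C', g * f = 1) :
    LinFlat C C' := by
  classical
  intro p q _ _ A hA c hc hAc
  set Sol := {b : p → MvPowerSeries (Fin n) k |
      (∀ j, b j ∈ C) ∧ ∀ i, ∑ j, A i j * b j = 0}
  let val : (p → C') →ₗ[C'] (p → MvPowerSeries (Fin n) k) :=
    LinearMap.pi fun j => (Algebra.linearMap C' (MvPowerSeries (Fin n) k)).comp (LinearMap.proj j)
  let K : Submodule C' (p → C') := (Submodule.span C' Sol).comap val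
  let c' : p → C' := fun j => ⟨c j, hc j⟩
  -- Elements `x y + 1` with `x` in the ideal have constant term `1` and so are units; this is the
  -- hypothesis of Krull's theorem.
  have hjac : maxIdeal C' ≤ Ideal.jacobson ⊥ := by
    intro x hx
    rw [Ideal.mem_jacobson_bot]
    intro y
    rw [mem_maxIdeal] at hx
    obtain ⟨g, hg, h⟩ := hunit (x * y + 1 : C').1 (x * y + 1 : C').2 (by
      change MvPowerSeries.constantCoeff ((x : MvPowerSeries (Fin n) k) * (y : MvPowerSeries (Fin n) k) + 1) ≠ 0
      rw [map_add, map_mul, hx, zero_mul, zero_add, map_one]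
      exact one_ne_zero)
    exact IsUnit.of_mul_eq_one ⟨g, hg⟩ (Subtype.ext ((mul_comm _ _).trans h))
  have hmono : ∀ (N : ℕ) (f : C), f ∈ maxIdeal C ^ N →
      (⟨f.1, hle f.2⟩ : C') ∈ maxIdeal C' ^ N := by
    intro N f hf
    have h1 := Ideal.mem_map_of_mem (Subalgebra.inclusion hle).toRingHom hf
    rw [Ideal.map_pow] at h1
    refine Ideal.pow_right_mono ?_ N h1
    rw [Ideal.map_le_iff_le_comap]
    exact fun x hx => hx
  let A' : (p → C) →ₗ[C] (q → C) := Matrix.mulVecLin (Matrix.of fun i j => ⟨A i j, hA i j⟩)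
  have hA' : ∀ b i, ((A' b i : C) : MvPowerSeries (Fin n) k) = ∑ j, A i j * (b j).1 := by
    intro b i
    change ((∑ j, (⟨A i j, hA i j⟩ : C) * b j : C) : MvPowerSeries (Fin n) k) = _
    rw [AddSubmonoidClass.coe_finsetSum]
    rfl
  -- Artin and Rees for the image of the matrix: a value of `A'` lying in the power `N + r` is the
  -- value of a vector with entries in the power `N`.
  obtain ⟨r, hr⟩ := Ideal.exists_pow_inf_eq_pow_smul (maxIdeal C) (LinearMap.range A')
  have happrox : ∀ N : ℕ, c' ∈ K ⊔ (maxIdeal C' ^ N • ⊤ : Submodule C' (p → C')) := by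
    intro N
    -- Truncating `c` gives an approximate solution over `C`; the extra `r` orders are what Artin
    -- and Rees consumes.
    choose g hgP hg using fun j => exists_poly_trunc (c j) (N + r)
    let c₀ : p → C := fun j => ⟨g j, hP (hgP j)⟩
    have h1 : A' c₀ ∈ maxIdeal C ^ (N + r) • ⊤ ⊓ LinearMap.range A' := by
      refine ⟨(mem_smul_top_pi _ _).2 fun i => mem_maxIdeal_pow hP hC _ fun b hb => ?_, c₀, rfl⟩
      rw [hA']
      have h2 : ∑ j, A i j * (c₀ j).1 = -∑ j, A i j * (c j - g j) := by
        simp only [mul_sub, Finset.sum_sub_distrib, hAc, zero_sub, neg_neg, c₀]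
      rw [h2, map_neg, map_sum, Finset.sum_eq_zero, neg_zero]
      exact fun j _ => coeff_mul_eq_zero_of_degree_lt _ (hg j) b hb
    rw [hr (N + r) (Nat.le_add_left _ _), Nat.add_sub_cancel] at h1
    have h3 := Submodule.smul_mono (le_refl (maxIdeal C ^ N))
      (inf_le_right : maxIdeal C ^ r • ⊤ ⊓ LinearMap.range A' ≤ LinearMap.range A') h1
    rw [LinearMap.range_eq_map, ← Submodule.map_smul''] at h3
    obtain ⟨e, he, hAe⟩ := h3
    rw [SetLike.mem_coe, mem_smul_top_pi] at he
    -- Correcting the truncation by the small vector `e` with the same image gives an exact solution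
    -- over `C`, still close to `c`.
    have hb : (fun j => (c₀ j - e j : C).1) ∈ Sol := by
      refine ⟨fun j => (c₀ j - e j).2, fun i => ?_⟩
      refine (hA' (c₀ - e) i).symm.trans ?_
      rw [map_sub, hAe, sub_self]
      rfl
    let b' : p → C' := fun j => ⟨(c₀ j - e j : C).1, hle (c₀ j - e j).2⟩
    have hbK : b' ∈ K := Submodule.subset_span hb
    have hd : c' - b' ∈ (maxIdeal C' ^ N • ⊤ : Submodule C' (p → C')) := by
      rw [mem_smul_top_pi]
      intro j
      have ht : (⟨c j - g j, sub_mem (hc j) (hle (hP (hgP j)))⟩ : C') ∈ maxIdeal C' ^ N :=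
        Ideal.pow_le_pow_right (Nat.le_add_right N r)
          (mem_maxIdeal_pow (hP.trans hle) hC' _ (hg j))
      have h4 : (c' - b') j = ⟨c j - g j, sub_mem (hc j) (hle (hP (hgP j)))⟩ +
          ⟨(e j).1, hle (e j).2⟩ := by
        refine Subtype.ext ?_
        change c j - (g j - (e j).1) = c j - g j + (e j).1
        ring
      rw [h4]
      exact add_mem ht (hmono N _ (he j))
    rw [← add_sub_cancel b' c']
    exact add_mem (Submodule.mem_sup_left hbK) (Submodule.mem_sup_right hd)
  suffices h : c' ∈ K from h
  rw [← Submodule.ker_mkQ K, LinearMap.mem_ker]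
  -- In the quotient by the span of the solutions, the class of `c` is divisible by all powers of
  -- the ideal, hence zero by Krull.
  have h5 : K.mkQ c' ∈ (⨅ i : ℕ, maxIdeal C' ^ i • ⊤ : Submodule C' ((p → C') ⧸ K)) := by
    rw [Submodule.mem_iInf]
    intro N
    have h6 := Submodule.mem_map_of_mem (f := K.mkQ) (happrox N)
    rwa [Submodule.map_sup, Submodule.mkQ_map_self, bot_sup_eq, Submodule.map_smul'',
      Submodule.map_top, Submodule.range_mkQ] at h6
  rwa [Ideal.iInf_pow_smul_eq_bot_of_le_jacobson _ hjac] at h5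

/-! ### The coefficient rings of the theorem -/

namespace CoeffRing

theorem shiftClosed_poly : ShiftClosed (poly k n).toSubalgebra := by
  classical
  rintro S γ _ ⟨f, rfl⟩
  have h : shiftPart S γ (f : MvPowerSeries (Fin n) k) =
      ∑ b ∈ f.support, if γ ≤ b ∧ b ∈ S then MvPowerSeries.monomial (b - γ) (f.coeff b) else 0 := by
    ext α
    rw [coeff_shiftPart, map_sum, MvPolynomial.coeff_coe]
    rw [Finset.sum_eq_single (α + γ)]
    · by_cases hα : α + γ ∈ S
      · simp [hα]
      · simp [hα]
    · intro b _ hb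
      split_ifs with h
      · rw [MvPowerSeries.coeff_monomial, if_neg]
        rintro rfl
        exact hb (tsub_add_cancel_of_le h.1).symm
      · exact map_zero _
    · intro hα
      rw [MvPolynomial.notMem_support_iff.1 hα]
      simp
  change shiftPart S γ (f : MvPowerSeries (Fin n) k) ∈ _
  rw [h]
  refine sum_mem fun b _ => ?_
  split_ifs
  · exact monomial_mem_poly _ _
  · exact zero_mem _

theorem shiftClosed_formal : ShiftClosed (formal k n).toSubalgebra := fun _ _ _ _ => trivial

theorem shiftClosed_analytic : ShiftClosed (analytic n).toSubalgebra := fun S γ _ hf =>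
  shiftPart_mem_analytic S γ hf

instance : IsNoetherianRing (poly k n).toSubalgebra :=
  inferInstanceAs (IsNoetherianRing (MvPolynomial.coeToMvPowerSeries.algHom (σ := Fin n)
    (R := k) k).range)

instance : IsNoetherianRing (formal k n).toSubalgebra :=
  isNoetherianRing_of_ringEquiv (MvPowerSeries (Fin n) k)
    (Subalgebra.topEquiv (R := k) (A := MvPowerSeries (Fin n) k)).symm.toRingEquiv

theorem exists_mul_eq_one_of_formal (f : MvPowerSeries (Fin n) k)
    (h0 : MvPowerSeries.constantCoeff f ≠ 0) : ∃ g, g * f = 1 :=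
  ⟨f⁻¹, MvPowerSeries.inv_mul_cancel f h0⟩

theorem linFlat_poly_formal : LinFlat (poly k n).toSubalgebra (formal k n).toSubalgebra :=
  linFlat_of_isNoetherianRing le_top le_rfl shiftClosed_poly.monomialClosed
    shiftClosed_formal.monomialClosed fun f _ h0 =>
      (exists_mul_eq_one_of_formal f h0).imp fun _ h => ⟨trivial, h⟩

theorem linFlat_poly_analytic : LinFlat (poly ℂ n).toSubalgebra (analytic n).toSubalgebra :=
  linFlat_of_isNoetherianRing (poly_le_alg.trans alg_le_analytic) le_rfl
    shiftClosed_poly.monomialClosed shiftClosed_analytic.monomialClosed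
    fun _ hf h0 => exists_mul_eq_one_of_analytic hf h0

theorem linFlat_analytic_formal : LinFlat (analytic n).toSubalgebra (formal ℂ n).toSubalgebra :=
  linFlat_of_isNoetherianRing le_top (poly_le_alg.trans alg_le_analytic)
    shiftClosed_analytic.monomialClosed shiftClosed_formal.monomialClosed fun f _ h0 =>
      (exists_mul_eq_one_of_formal f h0).imp fun _ h => ⟨trivial, h⟩

theorem exists_common_denominator {ι : Type*} [Fintype ι] (f : ι → MvPowerSeries (Fin n) k)
    (hf : ∀ i, f i ∈ (alg k n).toSubalgebra) :
    ∃ q ∈ (poly k n).toSubalgebra, (∃ g ∈ (alg k n).toSubalgebra, g * q = 1) ∧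
      ∀ i, q * f i ∈ (poly k n).toSubalgebra := by
  classical
  have hf' : ∀ i, ∃ p q : MvPolynomial (Fin n) k, MvPolynomial.constantCoeff q ≠ 0 ∧
    (q : MvPowerSeries (Fin n) k) * f i = p := hf
  choose p q hq h using hf'
  have hq' : MvPolynomial.constantCoeff (∏ i, q i) ≠ 0 := by
    rw [map_prod]
    exact Finset.prod_ne_zero_iff.2 fun i _ => hq i
  obtain ⟨g, hg⟩ := exists_mul_eq_one_of_formal
    ((∏ i, q i : MvPolynomial (Fin n) k) : MvPowerSeries (Fin n) k) (by
      rwa [← MvPowerSeries.coeff_zero_eq_constantCoeff_apply, MvPolynomial.coeff_coe,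
        ← MvPolynomial.constantCoeff_eq])
  refine ⟨((∏ i, q i : MvPolynomial (Fin n) k) : MvPowerSeries (Fin n) k), ⟨_, rfl⟩,
    ⟨g, ⟨1, ∏ i, q i, hq', ?_⟩, hg⟩, fun i => ⟨(∏ j ∈ Finset.univ.erase i, q j) * p i, ?_⟩⟩
  · rw [mul_comm, hg, MvPolynomial.coe_one]
  · change (((∏ j ∈ Finset.univ.erase i, q j) * p i : MvPolynomial (Fin n) k) :
      MvPowerSeries (Fin n) k) = _
    rw [← Finset.mul_prod_erase _ _ (Finset.mem_univ i), MvPolynomial.coe_mul,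
      MvPolynomial.coe_mul, ← h i]
    ring

/-- Multiplying a solution by a common denominator makes it polynomial, and the denominator is
invertible in the localization. -/
theorem linFlat_poly_alg : LinFlat (poly k n).toSubalgebra (alg k n).toSubalgebra := by
  intro p q _ _ A _ c hc hAc
  obtain ⟨d, -, ⟨g, hg, hgd⟩, hdc⟩ := exists_common_denominator c hc
  have h : c = (⟨g, hg⟩ : (alg k n).toSubalgebra) • fun j => d * c j := by
    funext j
    change c j = g * (d * c j)
    rw [← mul_assoc, hgd, one_mul]
  rw [h]
  refine Submodule.smul_mem _ _ (Submodule.subset_span ⟨hdc, fun i => ?_⟩)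
  simp only [mul_left_comm _ d]
  rw [← Finset.mul_sum, hAc, mul_zero]

/-- Here the denominators of the matrix are cleared instead; multiplying all equations by an
invertible series does not change the solutions. -/
theorem linFlat_alg_of_linFlat_poly {C : Subalgebra k (MvPowerSeries (Fin n) k)}
    (h : LinFlat (poly k n).toSubalgebra C) : LinFlat (alg k n).toSubalgebra C := by
  intro p q _ _ A hA c hc hAc
  obtain ⟨d, -, ⟨g, -, hgd⟩, hdA⟩ :=
    exists_common_denominator (fun x : q × p => A x.1 x.2) fun x => hA x.1 x.2
  refine Submodule.span_mono ?_ (h p q (fun i j => d * A i j) (fun i j => hdA (i, j)) c hc ?_)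
  · rintro b ⟨hb, hAb⟩
    refine ⟨fun j => poly_le_alg (hb j), fun i => ?_⟩
    have h1 := congrArg (fun x => g * x) (hAb i)
    simp only [mul_zero, Finset.mul_sum, ← mul_assoc, hgd, one_mul] at h1
    exact h1
  · intro i
    simp only [mul_assoc]
    rw [← Finset.mul_sum, hAc, mul_zero]

/-- An arbitrary part of the expansion of a rational function need not be rational, so `ShiftClosed`
is no route here. Clearing the denominator, which keeps all exponents in the monomial ideal, reduces
to polynomials. -/
theorem monomialClosed_alg : MonomialClosed (alg k n).toSubalgebra := by
  classical
  intro f hf T hT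
  obtain ⟨d, -, ⟨g, hg, hgd⟩, hdf⟩ := exists_common_denominator (fun _ : Unit => f) fun _ => hf
  have h1 := shiftClosed_poly.monomialClosed (d * f) (hdf ()) T fun b hb => by
    rw [MvPowerSeries.coeff_mul] at hb
    obtain ⟨x, hx, hxb⟩ := Finset.exists_ne_zero_of_sum_ne_zero hb
    rw [Finset.HasAntidiagonal.mem_antidiagonal] at hx
    obtain ⟨γ, hγ, hle⟩ := hT x.2 (right_ne_zero_of_mul hxb)
    exact ⟨γ, hγ, hle.trans (hx ▸ le_add_self)⟩
  have h2 : f = (⟨g, hg⟩ : (alg k n).toSubalgebra) • (d * f) := by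
    change f = g * (d * f)
    rw [← mul_assoc, hgd, one_mul]
  rw [h2]
  exact Submodule.smul_mem _ _
    (span_le_span_of_le poly_le_alg (fun v hv => Submodule.subset_span hv) h1)

end CoeffRing

end Flat
/-! ### Extension of left ideals along an extension of coefficients -/

section Extension

variable {k M R : Type*} [Field k] [CommRing M] [Algebra k M] [Ring R] [Module M R]
  [IsScalarTower M R R] {C' : Subalgebra k M} {T T' : Subring R}

theorem coef_smul_mul (c : C') (x y : R) : c • x * y = c • (x * y) := smul_mul_assoc (c : M) x y

/-- Since `T'` is spanned by `T` with coefficients on the left, `T' I = C' T I = C' I`. Thus the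
extended left ideal is a module obtained by extending coefficients, to which flatness applies. -/
theorem val_mem_span_of_mem_map (h : T ≤ T') (hT : ∀ x ∈ T', x ∈ Submodule.span C' (T : Set R))
    {I : Ideal T} {x : T'} (hx : x ∈ I.map (Subring.inclusion h)) :
    (x : R) ∈ Submodule.span C' (Subtype.val '' (I : Set T)) := by
  -- The claim is strengthened to all left multiples because the span is not visibly stable under
  -- `T'`.
  suffices H : ∀ a ∈ T', a * (x : R) ∈ Submodule.span C' (Subtype.val '' (I : Set T)) by
    simpa using H 1 (one_mem _)
  induction hx using Submodule.span_induction with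
  | mem x hx =>
    obtain ⟨y, hy, rfl⟩ := hx
    intro a ha
    replace ha := hT a ha
    induction ha using Submodule.span_induction with
    | mem t ht => exact Submodule.subset_span ⟨⟨t, ht⟩ * y, I.mul_mem_left _ hy, rfl⟩
    | zero =>
      rw [zero_mul]
      exact zero_mem _
    | add s t _ _ hs ht =>
      rw [add_mul]
      exact add_mem hs ht
    | smul c t _ ht =>
      rw [coef_smul_mul]
      exact Submodule.smul_mem _ c ht
  | zero => intro a _; simp
  | add x y _ _ hx hy =>
    intro a ha
    rw [Subring.coe_add, mul_add]
    exact add_mem (hx a ha) (hy a ha)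
  | smul b x _ hx =>
    intro a ha
    rw [smul_eq_mul, Subring.coe_mul, ← mul_assoc]
    exact hx _ (mul_mem ha b.2)

theorem mem_map_of_mem_span (h : T ≤ T') (hT : ∀ c : C', ∀ x ∈ T', c • x ∈ T') {I : Ideal T} {x : R}
    (hx : x ∈ Submodule.span C' (Subtype.val '' (I : Set T))) :
    ∃ hx : x ∈ T', (⟨x, hx⟩ : T') ∈ I.map (Subring.inclusion h) := by
  induction hx using Submodule.span_induction with
  | mem x hx =>
    obtain ⟨y, hy, rfl⟩ := hx
    exact ⟨h y.2, Ideal.mem_map_of_mem (Subring.inclusion h) hy⟩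
  | zero => exact ⟨zero_mem _, zero_mem _⟩
  | add x y _ _ hx hy =>
    obtain ⟨hx, hx'⟩ := hx
    obtain ⟨hy, hy'⟩ := hy
    exact ⟨add_mem hx hy, add_mem hx' hy'⟩
  | smul c x _ hx =>
    obtain ⟨hx, hx'⟩ := hx
    refine ⟨hT c x hx, ?_⟩
    have h1 : (⟨c • x, hT c x hx⟩ : T') = ⟨c • 1, hT c 1 (one_mem _)⟩ * ⟨x, hx⟩ := by
      refine Subtype.ext ?_
      change c • x = c • 1 * x
      rw [coef_smul_mul, one_mul]
    rw [h1]
    exact Ideal.mul_mem_left _ _ hx'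

/-- The elements of a left ideal of `T`, as a module over the coefficients. -/
def idealSubmodule (C : Subalgebra k M) (hT : ∀ c : C, ∀ x ∈ T, c • x ∈ T) (I : Ideal T) :
    Submodule C R where
  carrier := Subtype.val '' (I : Set T)
  add_mem' := by
    rintro _ _ ⟨x, hx, rfl⟩ ⟨y, hy, rfl⟩
    exact ⟨x + y, add_mem hx hy, rfl⟩
  zero_mem' := ⟨0, zero_mem _, rfl⟩
  smul_mem' := by
    rintro c _ ⟨x, hx, rfl⟩
    refine ⟨⟨c • 1, hT c 1 (one_mem _)⟩ * x, Ideal.mul_mem_left _ _ hx, ?_⟩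
    change c • 1 * (x : R) = c • (x : R)
    rw [coef_smul_mul, one_mul]

end Extension

/-! ### Descent of monomial conditions along a flat extension -/

section Descent

variable {k : Type*} [Field k] {n : ℕ}

/-- The span over `C` of the monomials with exponents in `Γ`. -/
def monomialSpan (C : Subalgebra k (MvPowerSeries (Fin n) k)) (Γ : Finset (Fin n →₀ ℕ)) :
    Submodule C (MvPowerSeries (Fin n) k) :=
  Submodule.span C ((fun γ => MvPowerSeries.monomial γ (1 : k)) '' (Γ : Set (Fin n →₀ ℕ)))

theorem exists_le_of_mem_monomialSpan {C : Subalgebra k (MvPowerSeries (Fin n) k)}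
    {Γ : Finset (Fin n →₀ ℕ)} {f : MvPowerSeries (Fin n) k} (hf : f ∈ monomialSpan C Γ)
    (b : Fin n →₀ ℕ) (hb : MvPowerSeries.coeff b f ≠ 0) : ∃ γ ∈ Γ, γ ≤ b := by
  classical
  induction hf using Submodule.span_induction generalizing b with
  | mem x hx =>
    obtain ⟨γ, hγ, rfl⟩ := hx
    rw [MvPowerSeries.coeff_monomial] at hb
    split_ifs at hb with h
    · exact ⟨γ, hγ, h.ge⟩
    · exact absurd rfl hb
  | zero => exact absurd (map_zero _) hb
  | add x y _ _ hx hy =>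
    rw [map_add] at hb
    by_cases h : MvPowerSeries.coeff b x = 0
    · rw [h, zero_add] at hb
      exact hy b hb
    · exact hx b h
  | smul c x _ hx =>
    change MvPowerSeries.coeff b ((c : MvPowerSeries (Fin n) k) * x) ≠ 0 at hb
    rw [MvPowerSeries.coeff_mul] at hb
    obtain ⟨y, hy, hyb⟩ := Finset.exists_ne_zero_of_sum_ne_zero hb
    rw [Finset.HasAntidiagonal.mem_antidiagonal] at hy
    obtain ⟨γ, hγ, hle⟩ := hx y.2 (right_ne_zero_of_mul hyb)
    exact ⟨γ, hγ, hle.trans (hy ▸ le_add_self)⟩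

/-- Let `C ⊆ C'` be flat.  An element of the extension to `C'` of a `C`-module `N` of vectors whose
coordinates lie in given monomial ideals is a combination of elements of `N` with the same
property. -/
theorem LinFlat.mem_span_of_coordinates {C C' : Subalgebra k (MvPowerSeries (Fin n) k)}
    (hflat : LinFlat C C') (hP : (CoeffRing.poly k n).toSubalgebra ≤ C)
    {V : Type*} [AddCommGroup V] [Module (MvPowerSeries (Fin n) k) V] {ι : Type}
    (φ : ι → V →ₗ[MvPowerSeries (Fin n) k] MvPowerSeries (Fin n) k)
    (hfin : ∀ v, {i | φ i v ≠ 0}.Finite) (N : Submodule C V) (hN : ∀ v ∈ N, ∀ i, φ i v ∈ C)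
    (Γ : ι → Finset (Fin n →₀ ℕ)) {P : V} (hPN : P ∈ Submodule.span C' (N : Set V))
    (hPΓ : ∀ i, φ i P ∈ monomialSpan C' (Γ i)) :
    P ∈ Submodule.span C' {Q | Q ∈ N ∧ ∀ i, φ i Q ∈ monomialSpan C (Γ i)} := by
  classical
  obtain ⟨m, f, g, rfl⟩ := Submodule.mem_span_set'.1 hPN
  -- Outside `F` every combination of the `g j` has zero coordinate, so finitely many equations
  -- suffice.
  let F : Finset ι := Finset.univ.biUnion fun j => (hfin (g j)).toFinset
  have hF : ∀ i ∉ F, ∀ j, φ i (g j) = 0 := by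
    intro i hi j
    by_contra h
    exact hi (Finset.mem_biUnion.2 ⟨j, Finset.mem_univ j, (hfin _).mem_toFinset.2 h⟩)
  have he : ∀ i, ∃ e : (Fin n →₀ ℕ) → C',
      ∑ γ ∈ Γ i, e γ • MvPowerSeries.monomial γ (1 : k) = φ i (∑ j, f j • (g j : V)) := fun i =>
    (Submodule.mem_span_image_finset_iff_exists_fun' _).1 (hPΓ i)
  choose e he using he
  -- The unknowns are the coefficients of the `g j` and, for each coordinate in `F`, the
  -- coefficients that express it by the monomials of `Γ i`. The `i`-th row of `A` equates the two
  -- expressions.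
  let p : Type := Fin m ⊕ (Σ i : F, Γ i)
  let A : F → p → MvPowerSeries (Fin n) k := fun i => Sum.elim (fun j => φ i (g j))
    fun x => if x.1 = i then -MvPowerSeries.monomial (x.2 : Fin n →₀ ℕ) (1 : k) else 0
  let c : p → MvPowerSeries (Fin n) k := Sum.elim (fun j => (f j : MvPowerSeries (Fin n) k))
    fun x => e x.1 x.2
  have hsum : ∀ (i : F) (b : p → MvPowerSeries (Fin n) k), ∑ x, A i x * b x =
      ∑ j, φ i (g j) * b (Sum.inl j) -
        ∑ γ : Γ i, b (Sum.inr ⟨i, γ⟩) * MvPowerSeries.monomial (γ : Fin n →₀ ℕ) (1 : k) := by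
    intro i b
    rw [Fintype.sum_sum_type, sub_eq_add_neg, Fintype.sum_sigma, Fintype.sum_eq_single i]
    · congr 1
      rw [← Finset.sum_neg_distrib]
      refine Finset.sum_congr rfl fun γ _ => ?_
      simp only [A, Sum.elim_inr, if_true]
      ring
    · intro i' hi'
      refine Finset.sum_eq_zero fun γ _ => ?_
      simp only [A, Sum.elim_inr, if_neg hi', zero_mul]
  let Ψ : (p → MvPowerSeries (Fin n) k) →ₗ[MvPowerSeries (Fin n) k] V :=
    ∑ j : Fin m, (LinearMap.proj (Sum.inl j : p)).smulRight (g j : V)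
  have hΨ : ∀ b, Ψ b = ∑ j, b (Sum.inl j) • (g j : V) := by
    intro b
    simp [Ψ]
  have hφΨ : ∀ i b, φ i (Ψ b) = ∑ j, φ i (g j) * b (Sum.inl j) := by
    intro i b
    rw [hΨ, map_sum]
    refine Finset.sum_congr rfl fun j _ => ?_
    rw [map_smul, smul_eq_mul, mul_comm]
  have hc : c ∈ Submodule.span C' {b : p → MvPowerSeries (Fin n) k |
      (∀ j, b j ∈ C) ∧ ∀ i, ∑ j, A i j * b j = 0} := by
    refine hflat p F A ?_ c ?_ ?_
    · rintro i (j | x)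
      · exact hN _ (g j).2 i
      · simp only [A, Sum.elim_inr]
        split_ifs
        · exact neg_mem (hP (monomial_mem_poly _ _))
        · exact zero_mem _
    · rintro (j | x)
      · exact (f j).2
      · exact (e x.1 x.2).2
    · intro i
      rw [hsum, ← hφΨ, hΨ, sub_eq_zero]
      refine (he i).symm.trans ?_
      rw [← Finset.sum_coe_sort]
      rfl
  have hPc : ∑ j, f j • (g j : V) = Ψ c := (hΨ c).symm
  rw [hPc]
  clear hPc
  -- Only membership in the span of the solutions matters now, so the induction is over arbitrary
  -- elements of that span.
  clear_value c
  induction hc using Submodule.span_induction with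
  | mem b hb =>
    refine Submodule.subset_span ⟨?_, fun i => ?_⟩
    · rw [hΨ]
      exact sum_mem fun j _ => N.smul_mem (⟨b (Sum.inl j), hb.1 _⟩ : C) (g j).2
    · rw [hφΨ]
      by_cases hi : i ∈ F
      · have h := hb.2 ⟨i, hi⟩
        rw [hsum, sub_eq_zero] at h
        rw [h]
        exact sum_mem fun γ _ => Submodule.smul_mem _ (⟨_, hb.1 (Sum.inr ⟨⟨i, hi⟩, γ⟩)⟩ : C)
          (Submodule.subset_span ⟨γ, γ.2, rfl⟩)
      · rw [Finset.sum_eq_zero fun j _ => by rw [hF i hi, zero_mul]]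
        exact zero_mem _
  | zero =>
    rw [map_zero]
    exact zero_mem _
  | add x y _ _ hx hy =>
    rw [map_add]
    exact add_mem hx hy
  | smul a x _ hx =>
    change Ψ ((a : MvPowerSeries (Fin n) k) • x) ∈ _
    rw [map_smul]
    exact Submodule.smul_mem _ a hx

end Descent

/-! ### Operators as modules over the power series -/

section Operators

variable {k : Type*} [Field k] {n : ℕ}

instance : Module (MvPowerSeries (Fin n) k) (DiffOp (derO k n)) :=
  inferInstanceAs (Module (MvPowerSeries (Fin n) k) ((Fin n →₀ ℕ) →₀ MvPowerSeries (Fin n) k))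

instance : Module (MvPowerSeries (Fin n) k) (DiffOp (derH k n)) :=
  inferInstanceAs (Module (MvPowerSeries (Fin n) k)
    ((Fin n →₀ ℕ) →₀ Polynomial (MvPowerSeries (Fin n) k)))

theorem coeff_smul_derO (c : MvPowerSeries (Fin n) k) (P : DiffOp (derO k n)) (β : Fin n →₀ ℕ) :
    DiffOp.coeff β (c • P) = c * DiffOp.coeff β P := rfl

theorem coeff_smul_derH (c : MvPowerSeries (Fin n) k) (P : DiffOp (derH k n)) (β : Fin n →₀ ℕ) :
    DiffOp.coeff β (c • P) = c • DiffOp.coeff β P := rfl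

namespace DiffOp

variable {B : Type*} [CommRing B] {Δ : CommDer B n}

theorem mono_zero_mul (b : B) (P : DiffOp Δ) : mono Δ 0 b * P = lcoef Δ b P := by
  rw [mul_def, lmul_mono, lpow_zero, mul_one]

theorem mono_zero_mul_mono (a b : B) (β : Fin n →₀ ℕ) :
    mono Δ 0 a * mono Δ β b = mono Δ β (a * b) := by
  rw [mono_zero_mul, lcoef_mono]

theorem coeff_mono_zero_mul (b : B) (P : DiffOp Δ) (β : Fin n →₀ ℕ) :
    coeff β (mono Δ 0 b * P) = b * coeff β P := by
  induction P using induction_mono with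
  | zero => rw [mul_zero, map_zero, mul_zero]
  | add P Q hP hQ => rw [mul_add, map_add, map_add, hP, hQ, mul_add]
  | mono γ a =>
    rw [mono_zero_mul_mono, coeff_mono, coeff_mono]
    split_ifs
    · rfl
    · rw [mul_zero]

end DiffOp

theorem smul_eq_mul_derO (c : MvPowerSeries (Fin n) k) (P : DiffOp (derO k n)) :
    c • P = DiffOp.mono (derO k n) 0 c * P :=
  DiffOp.ext fun β => by rw [coeff_smul_derO, DiffOp.coeff_mono_zero_mul]

theorem smul_eq_mul_derH (c : MvPowerSeries (Fin n) k) (P : DiffOp (derH k n)) :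
    c • P = DiffOp.mono (derH k n) 0 (Polynomial.C c) * P :=
  DiffOp.ext fun β => by
    rw [coeff_smul_derH, DiffOp.coeff_mono_zero_mul, Polynomial.smul_eq_C_mul]

instance : IsScalarTower (MvPowerSeries (Fin n) k) (DiffOp (derO k n)) (DiffOp (derO k n)) :=
  ⟨fun c P Q => by rw [smul_eq_mul, smul_eq_mul, smul_eq_mul_derO, smul_eq_mul_derO, mul_assoc]⟩

instance : IsScalarTower (MvPowerSeries (Fin n) k) (DiffOp (derH k n)) (DiffOp (derH k n)) :=
  ⟨fun c P Q => by rw [smul_eq_mul, smul_eq_mul, smul_eq_mul_derH, smul_eq_mul_derH, mul_assoc]⟩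

variable {C C' : CoeffRing k n}

theorem smul_mem_D (c : C.toSubalgebra) (P : DiffOp (derO k n)) (hP : P ∈ D C) : c • P ∈ D C :=
  mem_D.2 fun β => mul_mem c.2 (mem_D.1 hP β)

theorem smul_mem_hD (c : C.toSubalgebra) (P : DiffOp (derH k n)) (hP : P ∈ hD C) : c • P ∈ hD C :=
  mem_hD.2 fun β m => mul_mem c.2 (mem_hD.1 hP β m)

theorem mem_span_D {P : DiffOp (derO k n)} (hP : P ∈ D C') :
    P ∈ Submodule.span C'.toSubalgebra (D C : Set (DiffOp (derO k n))) := by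
  classical
  rw [← DiffOp.sum_mono P]
  refine sum_mem fun β _ => ?_
  have h : DiffOp.mono (derO k n) β (DiffOp.coeff β P) =
      (⟨_, mem_D.1 hP β⟩ : C'.toSubalgebra) • DiffOp.mono (derO k n) β 1 := by
    change _ = DiffOp.coeff β P • DiffOp.mono (derO k n) β 1
    rw [smul_eq_mul_derO, DiffOp.mono_zero_mul_mono, mul_one]
  rw [h]
  refine Submodule.smul_mem _ _ (Submodule.subset_span (mem_D.2 fun γ => ?_))
  rw [DiffOp.coeff_mono]
  split_ifs
  · exact one_mem _
  · exact zero_mem _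

theorem mono_monomial_mem_hD {c : MvPowerSeries (Fin n) k} (hc : c ∈ C.toSubalgebra)
    (β : Fin n →₀ ℕ) (m : ℕ) :
    DiffOp.mono (derH k n) β (Polynomial.monomial m c) ∈ hD C := by
  classical
  refine mem_hD.2 fun γ l => ?_
  rw [DiffOp.coeff_mono]
  split_ifs
  · rw [Polynomial.coeff_monomial]
    split_ifs
    · exact hc
    · exact zero_mem _
  · rw [Polynomial.coeff_zero]
    exact zero_mem _

theorem mem_span_hD {P : DiffOp (derH k n)} (hP : P ∈ hD C') :
    P ∈ Submodule.span C'.toSubalgebra (hD C : Set (DiffOp (derH k n))) := by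
  classical
  rw [← DiffOp.sum_mono P]
  refine sum_mem fun β _ => ?_
  rw [(DiffOp.coeff β P).as_sum_support, map_sum]
  refine sum_mem fun m _ => ?_
  have h : DiffOp.mono (derH k n) β (Polynomial.monomial m ((DiffOp.coeff β P).coeff m)) =
      (⟨_, mem_hD.1 hP β m⟩ : C'.toSubalgebra) •
        DiffOp.mono (derH k n) β (Polynomial.monomial m 1) := by
    change _ = (DiffOp.coeff β P).coeff m • DiffOp.mono (derH k n) β (Polynomial.monomial m 1)
    rw [smul_eq_mul_derH, DiffOp.mono_zero_mul_mono, Polynomial.C_mul_monomial, mul_one]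
  rw [h]
  exact Submodule.smul_mem _ _ (Submodule.subset_span (mono_monomial_mem_hD (one_mem _) β m))

/-! ### Homogenization and extension of coefficients -/

/-- The homogenization of operators of degree at most `d`:  `c_β ∂^β ↦ c_β ∂^β h^(d-|β|)`. -/
def homogAt (d : ℕ) : DiffOp (derO k n) →+ DiffOp (derH k n) :=
  DiffOp.liftAdd (derO k n) fun β =>
    (DiffOp.mono (derH k n) β).comp (Polynomial.monomial (d - β.degree)).toAddMonoidHom

theorem homogAt_mono (d : ℕ) (β : Fin n →₀ ℕ) (c : MvPowerSeries (Fin n) k) :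
    homogAt d (DiffOp.mono (derO k n) β c) =
      DiffOp.mono (derH k n) β (Polynomial.monomial (d - β.degree) c) :=
  DiffOp.liftAdd_mono _ _ _

theorem homogAt_deg (P : DiffOp (derO k n)) : homogAt (deg P) P = homog P := rfl

theorem homogAt_smul (d : ℕ) (c : MvPowerSeries (Fin n) k) (P : DiffOp (derO k n)) :
    homogAt d (c • P) = c • homogAt d P := by
  induction P using DiffOp.induction_mono with
  | zero => rw [smul_zero, map_zero, smul_zero]
  | add P Q hP hQ => rw [smul_add, map_add, map_add, hP, hQ, smul_add]
  | mono β b =>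
    rw [smul_eq_mul_derO, DiffOp.mono_zero_mul_mono, homogAt_mono, homogAt_mono, smul_eq_mul_derH,
      DiffOp.mono_zero_mul_mono, Polynomial.C_mul_monomial]

/-- `homog` is not additive, because the degree varies with the operator. Homogenizing to a fixed
degree is linear over the coefficients and costs only a power of `h`, which does not lead out of the
ideal. -/
theorem homogAt_of_deg_le {d : ℕ} {P : DiffOp (derO k n)} (h : deg P ≤ d) :
    homogAt d P =
      DiffOp.mono (derH k n) 0 (Polynomial.monomial (d - deg P) 1) * homog P := by
  rw [homogAt, DiffOp.liftAdd_apply, homog, Finset.mul_sum]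
  refine Finset.sum_congr rfl fun β hβ => ?_
  have hβd : β.degree ≤ deg P := Finset.le_sup hβ
  rw [DiffOp.mono_zero_mul_mono, Polynomial.monomial_mul_monomial, one_mul,
    show d - deg P + (deg P - β.degree) = d - β.degree by omega]
  rfl

theorem deg_le_iff {d : ℕ} {P : DiffOp (derO k n)} :
    deg P ≤ d ↔ ∀ β : Fin n →₀ ℕ, d < β.degree → DiffOp.coeff β P = 0 := by
  rw [deg, Finset.sup_le_iff]
  refine forall_congr' fun β => ?_
  rw [DiffOp.mem_supp, ← not_imp_not, not_le, not_not]

theorem hDincl_hElem (h : C.toSubalgebra ≤ C'.toSubalgebra) (P : D C) :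
    hDincl h (hElem P) = hElem (Dincl h P) := by
  refine Subtype.ext ?_
  rw [hDincl_val]
  change homog P.1 = homog (Dincl h P).1
  rw [Dincl_val]

/-- The coefficient of `∂^β`, as a linear map. -/
def coeffO (β : Fin n →₀ ℕ) :
    DiffOp (derO k n) →ₗ[MvPowerSeries (Fin n) k] MvPowerSeries (Fin n) k where
  __ := DiffOp.coeff β
  map_smul' c P := coeff_smul_derO c P β

theorem coeffO_apply (β : Fin n →₀ ℕ) (P : DiffOp (derO k n)) :
    coeffO β P = DiffOp.coeff β P := rfl

/-- The coefficient of `∂^β h^m`, as a linear map. -/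
def coeffH (e : (Fin n →₀ ℕ) × ℕ) :
    DiffOp (derH k n) →ₗ[MvPowerSeries (Fin n) k] MvPowerSeries (Fin n) k where
  toFun P := (DiffOp.coeff e.1 P).coeff e.2
  map_add' P Q := by rw [map_add, Polynomial.coeff_add]
  map_smul' c P := by
    rw [coeff_smul_derH, Polynomial.coeff_smul]
    rfl

theorem finite_coeffO (P : DiffOp (derO k n)) : {β | coeffO β P ≠ 0}.Finite :=
  (DiffOp.supp P).finite_toSet.subset fun _ h => DiffOp.mem_supp.2 h

theorem finite_coeffH (P : DiffOp (derH k n)) : {e | coeffH e P ≠ 0}.Finite := by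
  classical
  refine ((DiffOp.supp P).biUnion fun β =>
    (DiffOp.coeff β P).support.image (Prod.mk β)).finite_toSet.subset fun e he => ?_
  have he : (DiffOp.coeff e.1 P).coeff e.2 ≠ 0 := he
  refine Finset.mem_coe.2 (Finset.mem_biUnion.2 ⟨e.1, DiffOp.mem_supp.2 fun h => he ?_,
    Finset.mem_image.2 ⟨e.2, Polynomial.mem_support_iff.2 he, rfl⟩⟩)
  rw [h, Polynomial.coeff_zero]

theorem homogAt_mem_span (d : ℕ) {I : Ideal (D C)} {Q : D C} (hQ : Q ∈ I) (hd : deg Q.1 ≤ d) :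
    homogAt d Q.1 ∈ Subtype.val '' (hIdeal I : Set (hD C)) := by
  have h : hElem Q ∈ hIdeal I := Ideal.subset_span ⟨Q, hQ, rfl⟩
  refine ⟨⟨_, mono_monomial_mem_hD (one_mem _) 0 (d - deg Q.1)⟩ * hElem Q,
    Ideal.mul_mem_left _ _ h, ?_⟩
  have h1 : (hElem Q).1 = homog Q.1 := rfl
  rw [homogAt_of_deg_le hd, Subring.coe_mul, h1]

theorem homogAt_mem_span_of_mem_span (d : ℕ) {I : Ideal (D C)} {x : DiffOp (derO k n)}
    (hx : x ∈ Submodule.span C'.toSubalgebra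
      {Q | Q ∈ idealSubmodule C.toSubalgebra smul_mem_D I ∧ deg Q ≤ d}) :
    homogAt d x ∈ Submodule.span C'.toSubalgebra (Subtype.val '' (hIdeal I : Set (hD C))) := by
  induction hx using Submodule.span_induction with
  | mem Q hQ =>
    obtain ⟨⟨Q', hQI, hQ'⟩, hQd⟩ := hQ
    rw [← hQ'] at hQd ⊢
    exact Submodule.subset_span (homogAt_mem_span d hQI hQd)
  | zero =>
    rw [map_zero]
    exact zero_mem _
  | add x y _ _ hx hy =>
    rw [map_add]
    exact add_mem hx hy
  | smul c x _ hx =>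
    rw [Subalgebra.smul_def, homogAt_smul]
    exact Submodule.smul_mem _ c hx

/-- By flat descent `P` is a combination of elements of `I` of degree at most that of `P`. No higher
terms have to cancel, so the linear map `homogAt` can be applied to each summand. -/
theorem homog_mem_span (h : C.toSubalgebra ≤ C'.toSubalgebra)
    (hflat : LinFlat C.toSubalgebra C'.toSubalgebra)
    (hP : (CoeffRing.poly k n).toSubalgebra ≤ C.toSubalgebra) {I : Ideal (D C)} {P : D C'}
    (hPI : P ∈ I.map (Dincl h)) :
    homog P.1 ∈ Submodule.span C'.toSubalgebra (Subtype.val '' (hIdeal I : Set (hD C))) := by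
  classical
  rw [← homogAt_deg]
  have h1 : P.1 ∈ Submodule.span C'.toSubalgebra
      (idealSubmodule C.toSubalgebra smul_mem_D I : Set (DiffOp (derO k n))) :=
    val_mem_span_of_mem_map (D_mono h) (fun _ => mem_span_D) hPI
  have hN : ∀ v ∈ idealSubmodule C.toSubalgebra smul_mem_D I, ∀ β, coeffO β v ∈ C.toSubalgebra := by
    rintro _ ⟨Q, -, rfl⟩ β
    exact mem_D.1 Q.2 β
  -- The degree bound as a monomial condition: `{0}` generates the unit ideal and leaves a
  -- coefficient free, `∅` forces it to vanish.
  have hΓ : ∀ β, coeffO β P.1 ∈ monomialSpan C'.toSubalgebra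
      (if β.degree ≤ deg P.1 then {0} else ∅) := by
    intro β
    by_cases hβ : β.degree ≤ deg P.1
    · rw [if_pos hβ]
      have h3 : coeffO β P.1 = (⟨_, mem_D.1 P.2 β⟩ : C'.toSubalgebra) •
          MvPowerSeries.monomial 0 (1 : k) := (mul_one _).symm
      rw [h3]
      exact Submodule.smul_mem _ _ (Submodule.subset_span ⟨0, by simp, rfl⟩)
    · rw [coeffO_apply, deg_le_iff.1 (le_refl (deg P.1)) β (not_le.1 hβ)]
      exact zero_mem _
  have h2 := hflat.mem_span_of_coordinates hP coeffO finite_coeffO _ hN _ h1 hΓ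
  refine homogAt_mem_span_of_mem_span _ (Submodule.span_mono ?_ h2)
  rintro Q ⟨hQ, hQd⟩
  refine ⟨hQ, deg_le_iff.2 fun β hβ => ?_⟩
  have h5 := hQd β
  rw [if_neg (not_le.2 hβ)] at h5
  simpa [monomialSpan, coeffO_apply] using h5

/-! ### Initial ideals and extension of coefficients -/

theorem support_eq_empty_iff {P : DiffOp (derH k n)} : support P = ∅ ↔ P = 0 := by
  refine ⟨fun h => ?_, fun h => ?_⟩
  · refine DiffOp.ext fun β => Polynomial.ext fun m => MvPowerSeries.ext fun α => ?_
    by_contra hne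
    have h1 : (α, β, m) ∈ support P := by
      intro h2
      apply hne
      rw [map_zero, Polynomial.coeff_zero, map_zero]
      exact h2
    rw [h] at h1
    exact h1
  · refine Set.eq_empty_of_forall_notMem fun e he => he ?_
    rw [h, map_zero, Polynomial.coeff_zero, map_zero]

theorem RingFiltration.symb_eq_zero {R : Type*} [Ring R] {𝓕 : RingFiltration R} {r : ℝ}
    (a : 𝓕.F r) (h : (a : R) ∈ 𝓕.lt r) : 𝓕.symb r a = 0 := by
  have h1 : 𝓕.cls r a = 𝓕.cls r 0 := RingFiltration.cls_eq_cls.2 (by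
    rw [AddSubgroup.coe_zero, add_zero]
    exact neg_mem h)
  rw [RingFiltration.symb, h1, map_zero, map_zero]

/-- In degree `r` the symbol is the initial form if the order equals `r`, and zero if it is smaller.
-/
theorem symb_mem_inIdeal {w : Wloc n} {J : Ideal (hD C)} {P : hD C} (hP : P ∈ J) {r : ℝ}
    (hr : P ∈ (filt w C).F r) : (filt w C).symb r ⟨P, hr⟩ ∈ inIdeal w J := by
  have hz : P ∈ (filt w C).lt r → (filt w C).symb r ⟨P, hr⟩ ∈ inIdeal w J := fun h => by
    rw [RingFiltration.symb_eq_zero _ h]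
    exact zero_mem _
  -- The zero operator is treated apart: its `ord` is the supremum of the empty set, that is `0`,
  -- which may exceed `r`.
  rcases (support P.1).eq_empty_or_nonempty with h0 | h0
  · have h1 : P = 0 := Subtype.ext (support_eq_empty_iff.1 h0)
    exact hz (h1 ▸ zero_mem _)
  · have hle : ord w P ≤ r := by
      refine csSup_le (h0.image _) ?_
      rintro _ ⟨e, he, rfl⟩
      exact mem_filt.1 hr e he
    rcases hle.eq_or_lt with h1 | h1
    · subst h1
      exact Ideal.subset_span ⟨P, hP, rfl⟩
    · exact hz (RingFiltration.mem_lt.2 ⟨_, h1, mem_filt_ord w P⟩)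

theorem dot_le_dot_of_le {u : Fin n → ℝ} (hu : ∀ i, u i ≤ 0) {α β : Fin n →₀ ℕ} (h : α ≤ β) :
    dot u β ≤ dot u α :=
  Finset.sum_le_sum fun i _ => mul_le_mul_of_nonpos_left (Nat.cast_le.2 (h i)) (hu i)

/-- Uses `u ≤ 0`: multiplication by a coefficient never raises the order, so each filtration step is
a module over the coefficients. -/
theorem coef_mem_filt_zero (w : Wloc n) (c : C.toSubalgebra) :
    (⟨c • 1, smul_mem_hD c 1 (one_mem _)⟩ : hD C) ∈ (filt w C).F 0 := by
  classical
  rw [mem_filt]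
  intro e he
  change MvPowerSeries.coeff e.1 ((DiffOp.coeff e.2.1
    ((c : MvPowerSeries (Fin n) k) • (1 : DiffOp (derH k n)))).coeff e.2.2) ≠ 0 at he
  rw [smul_eq_mul_derH, mul_one, DiffOp.coeff_mono] at he
  split_ifs at he with h
  · rw [← h, dot_zero, add_zero, ← dot_zero w.1.1]
    exact dot_le_dot_of_le (fun i => (w.2 i).1) bot_le
  · simp at he

/-- The graded product lives in degree `0 + r`; this moves it to degree `r`. -/
theorem RingFiltration.exists_symb_mul {R : Type*} [Ring R] {𝓕 : RingFiltration R} {r : ℝ}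
    (a : 𝓕.F 0) (b : 𝓕.F r) :
    ∃ z : 𝓕.F r, (z : R) = a * b ∧ 𝓕.symb r z = 𝓕.symb 0 a * 𝓕.symb r b := by
  have h := 𝓕.mul_mem a.2 b.2
  rw [zero_add] at h
  refine ⟨⟨_, h⟩, rfl, ?_⟩
  rw [RingFiltration.symb, RingFiltration.symb, RingFiltration.symb, DirectSum.of_mul_of,
    RingFiltration.gmul_cls]
  exact DirectSum.of_eq_of_gradedMonoid_eq (RingFiltration.mk_cls_eq (zero_add r).symm rfl)

/-- Taking the symbol in a fixed degree `r` is additive and turns multiplication by a coefficient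
into multiplication by its symbol in degree `0`. So the elements of `F_r` whose symbol lies in `K`
form a module over the coefficients. -/
theorem exists_symb_mem_of_mem_span (w : Wloc n) {r : ℝ} (K : Ideal (filt w C).Gr)
    {S : Set (DiffOp (derH k n))}
    (hS : ∀ x ∈ S, ∃ y : (filt w C).F r, y.1.1 = x ∧ (filt w C).symb r y ∈ K)
    {x : DiffOp (derH k n)} (hx : x ∈ Submodule.span C.toSubalgebra S) :
    ∃ y : (filt w C).F r, y.1.1 = x ∧ (filt w C).symb r y ∈ K := by
  induction hx using Submodule.span_induction with
  | mem x hx => exact hS x hx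
  | zero =>
    refine ⟨0, rfl, ?_⟩
    rw [RingFiltration.symb_eq_zero _ (zero_mem _)]
    exact zero_mem _
  | add x y _ _ hx hy =>
    obtain ⟨a, rfl, ha⟩ := hx
    obtain ⟨b, rfl, hb⟩ := hy
    refine ⟨a + b, rfl, ?_⟩
    rw [RingFiltration.symb, map_add, map_add]
    exact add_mem ha hb
  | smul c x _ hx =>
    obtain ⟨a, rfl, ha⟩ := hx
    obtain ⟨z, hz, hsz⟩ := RingFiltration.exists_symb_mul ⟨_, coef_mem_filt_zero w c⟩ a
    refine ⟨z, ?_, ?_⟩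
    · rw [hz, Subring.coe_mul]
      change c • 1 * a.1.1 = c • a.1.1
      rw [coef_smul_mul, one_mul]
    · rw [hsz]
      exact Ideal.mul_mem_left _ _ ha

theorem hDincl_mem_hIdeal (h : C.toSubalgebra ≤ C'.toSubalgebra) {I : Ideal (D C)} {P : D C}
    (hP : P ∈ I) : hDincl h (hElem P) ∈ hIdeal (I.map (Dincl h)) := by
  rw [hDincl_hElem]
  exact Ideal.subset_span ⟨Dincl h P, Ideal.mem_map_of_mem _ hP, rfl⟩

theorem hElem_mem_map_hIdeal (h : C.toSubalgebra ≤ C'.toSubalgebra)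
    (hflat : LinFlat C.toSubalgebra C'.toSubalgebra)
    (hP : (CoeffRing.poly k n).toSubalgebra ≤ C.toSubalgebra) {I : Ideal (D C)} {P : D C'}
    (hPI : P ∈ I.map (Dincl h)) : hElem P ∈ (hIdeal I).map (hDincl h) := by
  obtain ⟨hx, h1⟩ := mem_map_of_mem_span (hD_mono h) smul_mem_hD (homog_mem_span h hflat hP hPI)
  have h2 : hElem P = ⟨homog P.1, hx⟩ := rfl
  rw [h2, hDincl]
  exact h1

/-- Homogenization commutes with flat extensions of the coefficients. -/
theorem map_hIdeal (h : C.toSubalgebra ≤ C'.toSubalgebra)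
    (hflat : LinFlat C.toSubalgebra C'.toSubalgebra)
    (hP : (CoeffRing.poly k n).toSubalgebra ≤ C.toSubalgebra) (I : Ideal (D C)) :
    (hIdeal I).map (hDincl h) = hIdeal (I.map (Dincl h)) := by
  refine le_antisymm (Ideal.map_le_iff_le_comap.2 (Ideal.span_le.2 ?_)) (Ideal.span_le.2 ?_)
  · rintro _ ⟨P, hPI, rfl⟩
    rw [SetLike.mem_coe, Ideal.mem_comap]
    exact hDincl_mem_hIdeal h hPI
  · rintro _ ⟨P, hPI, rfl⟩
    exact hElem_mem_map_hIdeal h hflat hP hPI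

theorem grIncl_symb (w : Wloc n) (h : C.toSubalgebra ≤ C'.toSubalgebra) {r : ℝ} {P : hD C}
    (hr : P ∈ (filt w C).F r) :
    grIncl w h ((filt w C).symb r ⟨P, hr⟩) =
      (filt w C').symb r ⟨hDincl h P, hDincl_mem_filt h hr⟩ :=
  RingFiltration.grMap_symb _ _ _ _

theorem grIncl_inForm_mem (w : Wloc n) (h : C.toSubalgebra ≤ C'.toSubalgebra) {J : Ideal (hD C)}
    {P : hD C} (hP : P ∈ J) : grIncl w h (inForm w P) ∈ inIdeal w (J.map (hDincl h)) := by
  rw [inForm, grIncl_symb]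
  exact symb_mem_inIdeal (Ideal.mem_map_of_mem _ hP) _

theorem exists_symb_mem_map (w : Wloc n) (h : C.toSubalgebra ≤ C'.toSubalgebra) {J : Ideal (hD C)}
    {r : ℝ} {Q : hD C} (hQ : Q ∈ J) (hQr : Q ∈ (filt w C).F r) :
    ∃ y : (filt w C').F r, y.1.1 = Q.1 ∧
      (filt w C').symb r y ∈ (inIdeal w J).map (grIncl w h) := by
  refine ⟨⟨hDincl h Q, hDincl_mem_filt h hQr⟩, hDincl_val h Q, ?_⟩
  rw [← grIncl_symb w h hQr]
  exact Ideal.mem_map_of_mem (grIncl w h) (symb_mem_inIdeal hQ hQr)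

/-- An element of order at most `r` of the extension of `J` is a combination of elements of `J` of
order at most `r`. -/
theorem mem_span_filt (w : Wloc n) (h : C.toSubalgebra ≤ C'.toSubalgebra)
    (hflat : LinFlat C.toSubalgebra C'.toSubalgebra)
    (hP : (CoeffRing.poly k n).toSubalgebra ≤ C.toSubalgebra)
    (hC' : MonomialClosed C'.toSubalgebra) {J : Ideal (hD C)} {r : ℝ} {P : hD C'}
    (hPJ : P ∈ J.map (hDincl h)) (hPr : P ∈ (filt w C').F r) :
    P.1 ∈ Submodule.span C'.toSubalgebra
      (Subtype.val '' {Q : hD C | Q ∈ J ∧ Q ∈ (filt w C).F r}) := by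
  have h1 : P.1 ∈ Submodule.span C'.toSubalgebra
      (idealSubmodule C.toSubalgebra smul_mem_hD J : Set (DiffOp (derH k n))) :=
    val_mem_span_of_mem_map (hD_mono h) (fun _ => mem_span_hD) hPJ
  -- The exponents allowed in the coefficient of `∂^β h^m` by the bound on the order; as `u ≤ 0`
  -- they are closed under passing to larger exponents, so they are the exponents of a monomial
  -- ideal.
  choose Γ hΓ hΓle using fun e : (Fin n →₀ ℕ) × ℕ =>
    CoeffRing.exists_finset_forall_exists_le {γ : Fin n →₀ ℕ | dot w.1.1 γ ≤ r - dot w.1.2 e.1}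
  have hN : ∀ v ∈ idealSubmodule C.toSubalgebra smul_mem_hD J, ∀ e,
      coeffH e v ∈ C.toSubalgebra := by
    rintro _ ⟨Q, -, rfl⟩ e
    exact mem_hD.1 Q.2 e.1 e.2
  have hPΓ : ∀ e, coeffH e P.1 ∈ monomialSpan C'.toSubalgebra (Γ e) := by
    intro e
    refine hC' _ (mem_hD.1 P.2 e.1 e.2) _ fun b hb => hΓle e b ?_
    have h3 : dot w.1.1 b + dot w.1.2 e.1 ≤ r := mem_filt.1 hPr (b, e.1, e.2) hb
    exact le_sub_iff_add_le.2 h3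
  have h2 := hflat.mem_span_of_coordinates hP coeffH finite_coeffH _ hN Γ h1 hPΓ
  refine Submodule.span_mono ?_ h2
  rintro _ ⟨⟨Q, hQJ, rfl⟩, hQΓ⟩
  refine ⟨Q, ⟨hQJ, ?_⟩, rfl⟩
  rw [mem_filt]
  intro e he
  obtain ⟨γ, hγ, hle⟩ := exists_le_of_mem_monomialSpan (hQΓ e.2) e.1 he
  have h3 := dot_le_dot_of_le (fun i => (w.2 i).1) hle
  have h4 : dot w.1.1 γ ≤ r - dot w.1.2 e.2.1 := hΓ e.2 hγ
  linarith

/-- Apply `mem_span_filt` with `r` the order of `P`: every term of the combination lies in the same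
step as `P`, so the initial form of `P` is the combination of their symbols in that degree. -/
theorem inForm_mem_map_inIdeal (w : Wloc n) (h : C.toSubalgebra ≤ C'.toSubalgebra)
    (hflat : LinFlat C.toSubalgebra C'.toSubalgebra)
    (hP : (CoeffRing.poly k n).toSubalgebra ≤ C.toSubalgebra)
    (hC' : MonomialClosed C'.toSubalgebra) {J : Ideal (hD C)} {P : hD C'}
    (hPJ : P ∈ J.map (hDincl h)) : inForm w P ∈ (inIdeal w J).map (grIncl w h) := by
  obtain ⟨y, hyP, hy⟩ := exists_symb_mem_of_mem_span w ((inIdeal w J).map (grIncl w h))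
    (by
      rintro _ ⟨Q, ⟨hQJ, hQr⟩, rfl⟩
      exact exists_symb_mem_map w h hQJ hQr)
    (mem_span_filt w h hflat hP hC' hPJ (mem_filt_ord w P))
  have hyP' : y = ⟨P, mem_filt_ord w P⟩ := Subtype.ext (Subtype.ext hyP)
  rwa [hyP'] at hy

/-- Passing to initial ideals commutes with flat extensions of the coefficients. -/
theorem map_inIdeal (w : Wloc n) (h : C.toSubalgebra ≤ C'.toSubalgebra)
    (hflat : LinFlat C.toSubalgebra C'.toSubalgebra)
    (hP : (CoeffRing.poly k n).toSubalgebra ≤ C.toSubalgebra)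
    (hC' : MonomialClosed C'.toSubalgebra) (J : Ideal (hD C)) :
    (inIdeal w J).map (grIncl w h) = inIdeal w (J.map (hDincl h)) := by
  refine le_antisymm (Ideal.map_le_iff_le_comap.2 (Ideal.span_le.2 ?_)) (Ideal.span_le.2 ?_)
  · rintro _ ⟨P, hPJ, rfl⟩
    rw [SetLike.mem_coe, Ideal.mem_comap]
    exact grIncl_inForm_mem w h hPJ
  · rintro _ ⟨P, hPJ, rfl⟩
    exact inForm_mem_map_inIdeal w h hflat hP hC' hPJ

theorem map_inIdeal_hIdeal (w : Wloc n) (h : C.toSubalgebra ≤ C'.toSubalgebra)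
    (hflat : LinFlat C.toSubalgebra C'.toSubalgebra)
    (hP : (CoeffRing.poly k n).toSubalgebra ≤ C.toSubalgebra)
    (hC' : MonomialClosed C'.toSubalgebra) (I : Ideal (D C)) :
    (inIdeal w (hIdeal I)).map (grIncl w h) = inIdeal w (hIdeal (I.map (Dincl h))) := by
  rw [map_inIdeal w h hflat hP hC', map_hIdeal h hflat hP]

end Operators
end LocalGroebner
end

/-! ### The four extensions of coefficient rings -/

open LocalGroebner

theorem mainTheorem9 {k : Type*} [Field k] (n : ℕ) (w : Wloc n) :
    (∀ I : Ideal (D (CoeffRing.poly k n)),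
      (inIdeal w (hIdeal I)).map (grIncl w CoeffRing.poly_le_alg) =
        inIdeal w (hIdeal (I.map (Dincl CoeffRing.poly_le_alg)))) ∧
    (∀ I : Ideal (D (CoeffRing.alg k n)),
      (inIdeal w (hIdeal I)).map (grIncl w CoeffRing.alg_le_formal) =
        inIdeal w (hIdeal (I.map (Dincl CoeffRing.alg_le_formal)))) ∧
    (∀ I : Ideal (D (CoeffRing.alg ℂ n)),
      (inIdeal w (hIdeal I)).map (grIncl w CoeffRing.alg_le_analytic) =
        inIdeal w (hIdeal (I.map (Dincl CoeffRing.alg_le_analytic)))) ∧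
    (∀ I : Ideal (D (CoeffRing.analytic n)),
      (inIdeal w (hIdeal I)).map (grIncl w CoeffRing.analytic_le_formal) =
        inIdeal w (hIdeal (I.map (Dincl CoeffRing.analytic_le_formal)))) := by
  refine ⟨?_, ?_, ?_, ?_⟩
  · exact map_inIdeal_hIdeal w _ CoeffRing.linFlat_poly_alg le_rfl CoeffRing.monomialClosed_alg
  · exact map_inIdeal_hIdeal w _
      (CoeffRing.linFlat_alg_of_linFlat_poly CoeffRing.linFlat_poly_formal)
      CoeffRing.poly_le_alg CoeffRing.shiftClosed_formal.monomialClosed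
  · exact map_inIdeal_hIdeal w _
      (CoeffRing.linFlat_alg_of_linFlat_poly CoeffRing.linFlat_poly_analytic)
      CoeffRing.poly_le_alg CoeffRing.shiftClosed_analytic.monomialClosed
  · exact map_inIdeal_hIdeal w _ CoeffRing.linFlat_analytic_formal
      (CoeffRing.poly_le_alg.trans CoeffRing.alg_le_analytic)
      CoeffRing.shiftClosed_formal.monomialClosed
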